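/- All $C^*$-algebras are complex and need not be unital. A $C^*$-algebra is \emph{AF} if it is the closure of the union of an increasing sequence of finite-dimensional $C^*$-subalgebras. Let $F$ be a finite-dimensional $C^*$-algebra. A \emph{minimal projection} of $F$ is a nonzero projection $p$ such that every projection $q \le p$ equals $0$ or $p$. A set $\{e_0,\dots,e_m\}\subset F$ is \emph{elementary} if the $e_i$ are mutually orthogonal minimal projections. For an integer $n \ge -1$, a completely positive map $\varphi : F \to A$ into a $C^*$-algebra $A$ has \emph{strict order not exceeding} $n$ if for every elementary set $\{e_0,\dots,e_{n+1}\}\subset F$ there are $i,j\in\{0,\dots,n+1\}$ with $\varphi(e_i)\varphi(e_j)=0$. (If $n \ge 0$, it does not matter whether $i=j$ is allowed.) The \emph{completely positive rank} of $A$ is at most $n$, written $\mathrm{cpr}\,A\le n$, if for all $a_1,\dots,a_k\in A$ and $\varepsilon>0$ there are a finite-dimensional $C^*$-algebra $F$ and completely positive contractions $\psi:A\to F$ and $\varphi:F\to A$ such that $\|\varphi\psi(a_i)-a_i\|<\varepsilon$ for $i=1,\dots,k$ and the strict order of $\varphi$ does not exceed $n$. One writes $\mathrm{cpr}\,A=n$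 if $n$ is the least integer $\ge -1$ with $\mathrm{cpr}\,A\le n$. \textbf{Theorem.} For a nonzero separable $C^*$-algebra $A$ the following are equivalent: (a) $A$ is AF; (b) $\mathrm{cpr}\,A=0$. -/

import Mathlib

open scoped CStarAlgebra

universe u

/-- `A` is an AF algebra: the closure of the union of an increasing sequence of finite-dimensional
C*-subalgebras (closedness of the members is automatic; units need not exist or be preserved). -/
def IsAFAlgebra (A : Type u) [NonUnitalCStarAlgebra A] : Prop :=
  ∃ S : ℕ → NonUnitalStarSubalgebra ℂ A,
    Monotone S ∧ (∀ n, FiniteDimensional ℂ (S n)) ∧ Dense (⋃ n, (S n : Set A))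

/-- A minimal projection: a nonzero projection `p` whose only subprojections are `0` and `p`. -/
def IsMinimalProjection {F : Type u} [NonUnitalCStarAlgebra F] [PartialOrder F] (p : F) : Prop :=
  IsStarProjection p ∧ p ≠ 0 ∧ ∀ q : F, IsStarProjection q → q ≤ p → q = 0 ∨ q = p

/-- The set `{e 0, …, e (m - 1)}` is elementary: the `e i` are mutually orthogonal minimal
projections. In particular they are pairwise distinct. -/
def IsElementary {F : Type u} [NonUnitalCStarAlgebra F] [PartialOrder F] {m : ℕ}
    (e : Fin m → F) : Prop :=
  (∀ i, IsMinimalProjection (e i)) ∧ ∀ i j, i ≠ j → e i * e j = 0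

/-- `ord φ ≤ n`: among any `n + 2` mutually orthogonal minimal projections there are `e i`, `e j`
with `φ (e i) ⟂ φ (e j)`. For `0 ≤ n` it makes no difference whether `i = j` is allowed, as
`φ (e i) ⟂ φ (e i)` means `φ (e i) = 0`. The notion is meant for `-1 ≤ n`. -/
def StrictOrderLE {F A : Type u} [NonUnitalCStarAlgebra F] [PartialOrder F] [StarOrderedRing F]
    [NonUnitalCStarAlgebra A] [PartialOrder A] [StarOrderedRing A]
    (φ : F →CP A) (n : ℤ) : Prop :=
  ∀ m : ℕ, (m : ℤ) = n + 2 → ∀ e : Fin m → F, IsElementary e →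
    ∃ i j, φ (e i) * φ (e j) = 0

/-- A triple `(F, ψ, φ)` consisting of a finite-dimensional C*-algebra `F` and completely positive
contractions `ψ : A → F`, `φ : F → A`. The order on `F` is the canonical one of a C*-algebra,
being determined by `StarOrderedRing F`. -/
structure CPFactorization (A : Type u) [NonUnitalCStarAlgebra A] [PartialOrder A]
    [StarOrderedRing A] where
  F : Type u
  [cstar : NonUnitalCStarAlgebra F]
  [order : PartialOrder F]
  [starOrdered : StarOrderedRing F]
  [finDim : FiniteDimensional ℂ F]
  ψ : A →CP F
  φ : F →CP A
  ψ_contractive : ∀ a, ‖ψ a‖ ≤ ‖a‖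
  φ_contractive : ∀ x, ‖φ x‖ ≤ ‖x‖

attribute [instance] CPFactorization.cstar CPFactorization.order CPFactorization.starOrdered
  CPFactorization.finDim

/-- `cpr A ≤ n`. -/
def CPRankLE (A : Type u) [NonUnitalCStarAlgebra A] [PartialOrder A] [StarOrderedRing A]
    (n : ℤ) : Prop :=
  ∀ (k : ℕ) (a : Fin k → A) (ε : ℝ), 0 < ε →
    ∃ T : CPFactorization A, (∀ i, ‖T.φ (T.ψ (a i)) - a i‖ < ε) ∧ StrictOrderLE T.φ n

/-- `cpr A = n`: `n` is the least integer with `cpr A ≤ n`, among the integers `≥ -1`, for which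
`cpr A ≤ n` is meaningful (the zero algebra has rank `-1`, like the empty space). -/
def HasCPRank (A : Type u) [NonUnitalCStarAlgebra A] [PartialOrder A] [StarOrderedRing A]
    (n : ℤ) : Prop :=
  IsLeast {m : ℤ | -1 ≤ m ∧ CPRankLE A m} n

/-! (a) ⇒ (b): a finite-dimensional subalgebra `B` nearly containing the given elements is the range
of a conditional expectation `E` (`exists_isConditionalExpectation`). Take `ψ = E` and for `φ` the
inclusion, which preserves orthogonality because it is multiplicative. To find `E`, the trace `τ` of
the regular representation of `B` is extended to a positive functional on `A` by the Riesz extension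
theorem, made `B`-invariant by averaging against a Casimir element, and dualized through `τ (E a *
x) = ω (a * x)`. Rank `-1` is impossible, as `φ` would kill the minimal projections, which span `F`.

(b) ⇒ (a): a completely positive map of order zero satisfies `φ x * φ y = φ 1 * φ (x * y)`
(`StrictOrderLE.map_mul_map`), so it would be a *-homomorphism if `φ 1` were a projection. One
therefore compresses to a corner where this nearly holds. Let `e'` be almost a unit for the given
positive contractions `a`, and `e` almost a unit for `e'`. Then `φ (ψ e)` is almost a unit for `φ (ψ
e')`, so `φ q` is almost idempotent when `q` is a spectral projection of `ψ e'` away from `0`.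
Functional calculus turns `φ` on `qFq` into a nearby *-homomorphism, whose range is
finite-dimensional. Since `e' * a * e' ≤ e'`, cutting `ψ (e' * a * e')` down by `q` costs little.
Hence finite sets are almost contained in finite-dimensional subalgebras.

It remains to nest these subalgebras. By `exists_unitary_conjugation`, a finite-dimensional algebra
almost contained in `B` is conjugated into `B` by a unitary close to `1`: a linear approximation is
made multiplicative by Newton's method, then *-preserving by a similarity inside `B`, and the polar
decomposition of an intertwiner provides the unitary. With separability this produces an increasing
sequence. -/

open Filter Topology Finset

/-! ### Finite-dimensional C*-algebras: unit, spectral decomposition, minimal projections. -/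

section FiniteDimensional

/-- A finite-dimensional C*-algebra has a unit. -/
theorem exists_unit_of_finiteDimensional (F : Type*) [NonUnitalCStarAlgebra F]
    [FiniteDimensional ℂ F] :
    ∃ u : F, IsStarProjection u ∧ ∀ x, u * x = x ∧ x * u = x := by
  let : PartialOrder F := CStarAlgebra.spectralOrder F
  have : StarOrderedRing F := CStarAlgebra.spectralOrderedRing F
  have : ProperSpace F := FiniteDimensional.proper ℂ F
  have hl := CStarAlgebra.increasingApproximateUnit F
  have := hl.neBot
  -- By compactness of the unit ball the approximate unit has a cluster point, which must be a unit.
  obtain ⟨u, -, hu⟩ := (isCompact_closedBall (0 : F) 1).exists_clusterPt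
    (f := CStarAlgebra.approximateUnit F)
    (le_principal_iff.2 (by filter_upwards [hl.eventually_norm] with x hx; simpa using hx))
  have : NeBot (𝓝 u ⊓ CStarAlgebra.approximateUnit F) := hu
  have h (x : F) : u * x = x ∧ x * u = x := by
    have hid : Tendsto (fun y : F => y) (𝓝 u ⊓ CStarAlgebra.approximateUnit F) (𝓝 u) :=
      tendsto_id'.2 inf_le_left
    exact ⟨tendsto_nhds_unique (hid.mul_const x) ((hl.tendsto_mul_right x).mono_left inf_le_right),
      tendsto_nhds_unique (hid.const_mul x) ((hl.tendsto_mul_left x).mono_left inf_le_right)⟩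
  have hs : star u = u := by
    have h1 := (h (star u)).1
    have h2 : star (u * star u) = star u := by rw [star_mul, star_star, h1]
    rw [h1, star_star] at h2
    exact h2.symm
  exact ⟨u, ⟨(h u).1, hs⟩, h⟩

theorem spectrum_finite_of_finiteDimensional {A : Type*} [Ring A] [Algebra ℂ A]
    [FiniteDimensional ℂ A] (a : A) : (spectrum ℂ a).Finite := by
  refine ((minpoly ℂ a).rootSet_finite ℂ).subset fun z hz => ?_
  have hint := Algebra.IsIntegral.isIntegral (R := ℂ) a
  rw [Polynomial.mem_rootSet]
  refine ⟨minpoly.ne_zero hint, ?_⟩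
  have h1 := spectrum.subset_polynomial_aeval a (minpoly ℂ a) ⟨z, hz, rfl⟩
  rw [minpoly.aeval] at h1
  have : Nontrivial A := by
    by_contra h
    rw [not_nontrivial_iff_subsingleton] at h
    simp at hz
  simpa using h1

theorem finite_unitization (F : Type*) [NonUnitalCStarAlgebra F] [FiniteDimensional ℂ F] :
    FiniteDimensional ℂ (Unitization ℂ F) :=
  Module.Finite.of_surjective
    ((LinearMap.toSpanSingleton ℂ (Unitization ℂ F) 1).coprod (Unitization.inrHom ℂ ℂ F)) fun x =>
      ⟨(x.fst, x.snd), by ext <;> simp⟩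

variable {F : Type*} [NonUnitalCStarAlgebra F] [FiniteDimensional ℂ F]

theorem quasispectrum_finite_of_finiteDimensional (a : F) : (quasispectrum ℝ a).Finite := by
  have := finite_unitization F
  rw [← quasispectrum.preimage_algebraMap ℂ]
  refine Set.Finite.preimage (algebraMap ℝ ℂ).injective.injOn ?_
  rw [Unitization.quasispectrum_eq_spectrum_inr' ℂ ℂ]
  exact spectrum_finite_of_finiteDimensional _

theorem continuousOn_quasispectrum (f : ℝ → ℝ) (a : F) : ContinuousOn f (quasispectrum ℝ a) :=
  (quasispectrum_finite_of_finiteDimensional a).continuousOn f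

/-- A function of a self-adjoint element that only takes the values `0` and `1` is a projection. -/
theorem isStarProjection_cfcₙ (f : ℝ → ℝ) (a : F) (hf : ∀ t, f t * f t = f t) :
    IsStarProjection (cfcₙ f a) := by
  refine ⟨?_, cfcₙ_predicate f a⟩
  -- Outside the domain of the calculus `cfcₙ` takes the default value `0`, which is also a
  -- projection.
  by_cases ha : IsSelfAdjoint a
  · by_cases h0 : f 0 = 0
    · rw [IsIdempotentElem, ← cfcₙ_mul f f a (continuousOn_quasispectrum f a) h0
        (continuousOn_quasispectrum f a) h0]
      simp only [hf]
    · simp [IsIdempotentElem, cfcₙ_apply_of_not_map_zero a h0]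
  · simp [IsIdempotentElem, cfcₙ_apply_of_not_predicate a ha]

/-- The spectral decomposition of a self-adjoint element. -/
theorem IsSelfAdjoint.exists_spectral_decomposition {a : F} (ha : IsSelfAdjoint a) :
    ∃ (s : Finset ℝ) (e : ℝ → F), (∀ t ∈ s, t ∈ quasispectrum ℝ a) ∧
      (∀ t, IsStarProjection (e t)) ∧ (∀ t r, t ≠ r → e t * e r = 0) ∧ a = ∑ t ∈ s, t • e t := by
  classical
  set S := (quasispectrum_finite_of_finiteDimensional a).toFinset with hS
  -- Excluding `t = 0` makes every `χ t` vanish at `0`, as the non-unital calculus requires; the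
  -- term of `t = 0` contributes nothing anyway.
  let χ : ℝ → ℝ → ℝ := fun t r => if r = t ∧ t ≠ 0 then 1 else 0
  have hχ0 (t) : χ t 0 = 0 := by
    simp only [χ]; split_ifs with h
    · exact absurd h.1.symm h.2
    · rfl
  have hc (f : ℝ → ℝ) := continuousOn_quasispectrum f a
  refine ⟨S, fun t => cfcₙ (χ t) a, by simp [hS], fun t => isStarProjection_cfcₙ _ _ fun r => ?_,
    fun t r htr => ?_, ?_⟩
  · simp only [χ]; split_ifs <;> simp
  · rw [← cfcₙ_mul _ _ a (hc _) (hχ0 t) (hc _) (hχ0 r)]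
    have : (fun x => χ t x * χ r x) = fun _ => 0 := by
      funext x
      simp only [χ]; split_ifs with h1 h2 <;> simp
      exact htr (h1.1.symm.trans h2.1)
    rw [this, cfcₙ_const_zero]
  · conv_lhs => rw [← cfcₙ_id' ℝ a]
    have : ∀ t ∈ S, t • cfcₙ (χ t) a = cfcₙ (fun r => t * χ t r) a := fun t _ =>
      (cfcₙ_const_mul t (χ t) a (hc _) (hχ0 t)).symm
    rw [Finset.sum_congr rfl this, ← cfcₙ_sum _ a S (fun _ _ => hc _) (fun t _ => by simp [hχ0])]
    refine cfcₙ_congr fun r hr => ?_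
    have hrS : r ∈ S := by simpa [hS] using hr
    simp only [Finset.sum_apply]
    rw [Finset.sum_eq_single r]
    · by_cases h : r = 0 <;> simp [χ, h]
    · intro t _ htr
      simp [χ, Ne.symm htr]
    · exact fun h => absurd hrS h

theorem span_isStarProjection_eq_top :
    Submodule.span ℂ {e : F | IsStarProjection e} = ⊤ := by
  rw [eq_top_iff]
  have hsa (a : F) (ha : IsSelfAdjoint a) : a ∈ Submodule.span ℂ {e : F | IsStarProjection e} := by
    obtain ⟨s, e, -, he, -, rfl⟩ := ha.exists_spectral_decomposition
    refine sum_mem fun t _ => ?_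
    have : t • e t = (t : ℂ) • e t := (Complex.coe_smul t (e t)).symm
    rw [this]
    exact Submodule.smul_mem _ _ (Submodule.subset_span (he t))
  intro x _
  rw [← realPart_add_I_smul_imaginaryPart x]
  exact add_mem (hsa _ (realPart x).2) (Submodule.smul_mem _ _ (hsa _ (imaginaryPart x).2))

variable [PartialOrder F] [StarOrderedRing F]

/-- Every projection of a finite-dimensional C*-algebra is a linear combination of minimal
projections below it. -/
theorem IsStarProjection.mem_span_isMinimalProjection {p : F} (hp : IsStarProjection p) :
    p ∈ Submodule.span ℂ {e : F | IsMinimalProjection e ∧ e ≤ p} := by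
  -- Induction on `dim pF`: a non-minimal `p` splits into `q` and `p - q`, whose right ideals are
  -- strictly smaller.
  induction hn : Module.finrank ℂ (LinearMap.range (LinearMap.mulLeft ℂ p))
    using Nat.strong_induction_on generalizing p with
  | _ n ih =>
  by_cases hp0 : p = 0
  · rw [hp0]; exact zero_mem _
  by_cases hmin : IsMinimalProjection p
  · exact Submodule.subset_span ⟨hmin, le_rfl⟩
  simp only [IsMinimalProjection, not_and, not_forall] at hmin
  obtain ⟨q, hq, hqp, hne⟩ := hmin hp hp0
  rw [not_or] at hne
  have key (r : F) (hr : IsStarProjection r) (hrp : r ≤ p) (hrne : r ≠ p) :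
      r ∈ Submodule.span ℂ {e : F | IsMinimalProjection e ∧ e ≤ p} := by
    have h1 := (hr.le_iff_mul_eq_right hp).1 hrp
    have h2 := (hr.le_iff_mul_eq_left hp).1 hrp
    refine Submodule.span_mono ?_ (ih _ ?_ hr rfl)
    · exact fun e he => ⟨he.1, he.2.trans hrp⟩
    · rw [← hn]
      refine Submodule.finrank_lt_finrank_of_lt (lt_of_le_of_ne ?_ fun heq => hrne ?_)
      · rintro _ ⟨x, rfl⟩
        exact ⟨r * x, by simp [← mul_assoc, h1]⟩
      · have : p ∈ LinearMap.range (LinearMap.mulLeft ℂ r) := by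
          rw [heq]; exact ⟨p, hp.isIdempotentElem⟩
        obtain ⟨x, hx⟩ := this
        have h3 : r * p = p := by
          rw [← hx, LinearMap.mulLeft_apply, ← mul_assoc, hr.isIdempotentElem.eq]
        rw [← h3, h2]
  have hsub : IsStarProjection (p - q) := (hq.le_iff_sub hp).1 hqp
  have := add_mem (key q hq hqp hne.2) (key (p - q) hsub (sub_le_self _ hq.nonneg) (by
    simpa using hne.1))
  simpa using this

theorem span_isMinimalProjection_eq_top :
    Submodule.span ℂ {e : F | IsMinimalProjection e} = ⊤ := by
  rw [eq_top_iff, ← span_isStarProjection_eq_top, Submodule.span_le]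
  intro p hp
  exact Submodule.span_mono (fun e he => he.1) (IsStarProjection.mem_span_isMinimalProjection hp)

end FiniteDimensional

/-! ### The regular trace, its orthonormal frames and the Casimir element. -/

section RegularTrace

/-- The conclusion mentions only the form `c.inner`, so the norm it induces stays local and cannot
compete with the C*-norm. -/
theorem InnerProductSpace.Core.exists_orthonormal_expansion {V : Type*} [AddCommGroup V]
    [Module ℂ V] [FiniteDimensional ℂ V] (c : InnerProductSpace.Core ℂ V) :
    ∃ (n : ℕ) (f : Fin n → V), (∀ x, x = ∑ i, c.inner (f i) x • f i) ∧
      ∀ L : V →ₗ[ℂ] V, LinearMap.trace ℂ V L = ∑ i, c.inner (f i) (L (f i)) := by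
  let _ : NormedAddCommGroup V := c.toNormedAddCommGroup
  let _ : InnerProductSpace ℂ V := .ofCore c.toCore
  let b := stdOrthonormalBasis ℂ V
  exact ⟨_, b, fun x => (b.sum_repr' x).symm, fun L => LinearMap.trace_eq_sum_inner L b⟩

variable {F : Type*} [NonUnitalCStarAlgebra F]

variable (F) in
/-- The trace of the left regular representation. -/
noncomputable def regularTrace : F →ₗ[ℂ] ℂ := LinearMap.trace ℂ F ∘ₗ LinearMap.mul ℂ F

theorem regularTrace_mul_comm (x y : F) : regularTrace F (x * y) = regularTrace F (y * x) := by
  have h (a b : F) : LinearMap.mul ℂ F (a * b) = LinearMap.mul ℂ F a * LinearMap.mul ℂ F b := by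
    ext z; simp [mul_assoc]
  simp only [regularTrace, LinearMap.comp_apply, h, LinearMap.trace_mul_comm ℂ (LinearMap.mul ℂ F x)]

variable [FiniteDimensional ℂ F]

theorem IsStarProjection.regularTrace_eq {e : F} (he : IsStarProjection e) :
    regularTrace F e = Module.finrank ℂ (LinearMap.range (LinearMap.mul ℂ F e)) := by
  have h : IsIdempotentElem (LinearMap.mul ℂ F e) := by
    ext z; simp [← mul_assoc, he.isIdempotentElem.eq]
  exact (LinearMap.IsIdempotentElem.isProj_range _ h).trace

/-- The trace is the sum of the spectral values weighted by the ranks of the spectral projections. A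
projection of rank zero in the regular representation vanishes, since `e * e = e`. Positivity is
phrased through the quasispectrum because no order on `F` is fixed here. -/
theorem IsSelfAdjoint.exists_regularTrace_eq {a : F} (ha : IsSelfAdjoint a) :
    ∃ r : ℝ, regularTrace F a = r ∧ ((∀ t ∈ quasispectrum ℝ a, 0 ≤ t) → 0 ≤ r ∧ (r = 0 → a = 0)) := by
  obtain ⟨s, e, hs, he, -, hsum⟩ := ha.exists_spectral_decomposition
  refine ⟨∑ t ∈ s, t * Module.finrank ℂ (LinearMap.range (LinearMap.mul ℂ F (e t))), ?_, ?_⟩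
  · conv_lhs => rw [hsum]
    rw [map_sum]
    push_cast
    refine Finset.sum_congr rfl fun t _ => ?_
    rw [← Complex.coe_smul t (e t), map_smul, (he t).regularTrace_eq, smul_eq_mul]
  · intro hpos
    have hnn : ∀ t ∈ s, 0 ≤ t * (Module.finrank ℂ (LinearMap.range (LinearMap.mul ℂ F (e t))) : ℝ) :=
      fun t ht => mul_nonneg (hpos t (hs t ht)) (Nat.cast_nonneg _)
    refine ⟨Finset.sum_nonneg hnn, fun h0 => ?_⟩
    rw [hsum]
    refine Finset.sum_eq_zero fun t ht => ?_
    rcases mul_eq_zero.1 ((Finset.sum_eq_zero_iff_of_nonneg hnn).1 h0 t ht) with h | h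
    · rw [h, zero_smul]
    · have h1 : LinearMap.mul ℂ F (e t) = 0 := by
        rw [← LinearMap.range_eq_bot]
        exact Submodule.finrank_eq_zero.1 (by exact_mod_cast h)
      have h2 : e t * e t = 0 := by
        have := congrArg (fun L : F →ₗ[ℂ] F => L (e t)) h1
        simpa using this
      rw [← (he t).isIdempotentElem.eq, h2, smul_zero]

theorem regularTrace_star (x : F) : regularTrace F (star x) = star (regularTrace F x) := by
  obtain ⟨r, hr, -⟩ := (realPart x).2.exists_regularTrace_eq
  obtain ⟨s, hs, -⟩ := (imaginaryPart x).2.exists_regularTrace_eq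
  rw [← realPart_add_I_smul_imaginaryPart x]
  simp only [star_add, star_smul, map_add, map_smul, (realPart x).2.star_eq,
    (imaginaryPart x).2.star_eq, hr, hs]
  simp

theorem regularTrace_star_mul_self (x : F) :
    ∃ r : ℝ, regularTrace F (star x * x) = r ∧ 0 ≤ r ∧ (r = 0 → x = 0) := by
  let _ : PartialOrder F := CStarAlgebra.spectralOrder F
  have : StarOrderedRing F := CStarAlgebra.spectralOrderedRing F
  obtain ⟨r, hr, h⟩ := (IsSelfAdjoint.star_mul_self x).exists_regularTrace_eq
  have h' := h fun t ht => quasispectrum_nonneg_of_nonneg _ (star_mul_self_nonneg x) t ht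
  exact ⟨r, hr, h'.1, fun h0 => CStarRing.star_mul_self_eq_zero_iff x |>.1 (h'.2 h0)⟩

variable (F) in
/-- The inner product `⟪x, y⟫ = τ (x* y)` attached to the regular trace `τ`. -/
noncomputable abbrev regularTraceCore : InnerProductSpace.Core ℂ F where
  inner x y := regularTrace F (star x * y)
  conj_inner_symm x y := by
    rw [starRingEnd_apply, ← regularTrace_star, star_mul, star_star]
  re_inner_nonneg x := by
    obtain ⟨r, hr, h, -⟩ := regularTrace_star_mul_self x
    rw [hr]; simpa using h
  add_left x y z := by simp [add_mul]
  smul_left x y r := by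
    rw [star_smul, smul_mul_assoc]
    exact map_smul (regularTrace F) _ _
  definite x h := by
    obtain ⟨r, hr, -, h'⟩ := regularTrace_star_mul_self x
    exact h' (by rw [hr] at h; exact_mod_cast h)

theorem eq_of_forall_regularTrace_mul_eq {x y : F}
    (h : ∀ z, regularTrace F (z * x) = regularTrace F (z * y)) : x = y := by
  obtain ⟨r, hr, -, h'⟩ := regularTrace_star_mul_self (x - y)
  refine sub_eq_zero.1 (h' ?_)
  have h0 : regularTrace F (star (x - y) * (x - y)) = 0 := by rw [mul_sub, map_sub, h, sub_self]
  rw [hr] at h0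
  exact_mod_cast h0

/-- A finite family is a trace frame if it is an orthonormal basis for `⟪x, y⟫ = τ (x* y)`, as
expressed by the expansion of vectors and by the formula for traces. -/
structure IsTraceFrame {n : ℕ} (f : Fin n → F) : Prop where
  expand : ∀ x, x = ∑ i, regularTrace F (star (f i) * x) • f i
  trace : ∀ L : F →ₗ[ℂ] F, LinearMap.trace ℂ F L = ∑ i, regularTrace F (star (f i) * L (f i))

variable (F) in
theorem exists_isTraceFrame : ∃ (n : ℕ) (f : Fin n → F), IsTraceFrame f := by
  obtain ⟨n, f, h1, h2⟩ := (regularTraceCore F).exists_orthonormal_expansion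
  exact ⟨n, f, h1, h2⟩

namespace IsTraceFrame

variable {n : ℕ} {f : Fin n → F}

theorem expand_star (hf : IsTraceFrame f) (x : F) :
    x = ∑ i, regularTrace F (x * f i) • star (f i) := by
  conv_lhs => rw [← star_star x, hf.expand (star x)]
  rw [star_sum]
  refine Finset.sum_congr rfl fun i _ => ?_
  rw [star_smul, ← regularTrace_star, star_mul, star_star, star_star]

/-- The element `∑ f i ⊗ (f i)*` is a Casimir element. -/
theorem casimir (hf : IsTraceFrame f) {M : Type*} [AddCommGroup M] [Module ℂ M]
    (β : F →ₗ[ℂ] F →ₗ[ℂ] M) (x : F) :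
    ∑ i, β (x * f i) (star (f i)) = ∑ i, β (f i) (star (f i) * x) := by
  -- Expanded in the frame, both sides become the double sum of `τ (f j* x f i) β (f j) (f i*)`.
  have h1 (i) : β (x * f i) (star (f i)) =
      ∑ j, regularTrace F (star (f j) * (x * f i)) • β (f j) (star (f i)) := by
    conv_lhs => rw [hf.expand (x * f i)]
    simp [map_sum, LinearMap.sum_apply]
  have h2 (i) : β (f i) (star (f i) * x) =
      ∑ j, regularTrace F (star (f i) * x * f j) • β (f i) (star (f j)) := by
    conv_lhs => rw [hf.expand_star (star (f i) * x)]
    simp [map_sum]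
  simp only [h1, h2]
  rw [Finset.sum_comm]
  simp only [mul_assoc]

/-- Pairing the sum with `z` gives `∑ τ (f i* z f i)`, the trace of left multiplication by `z`,
which is `τ z` by definition; faithfulness of `τ` concludes. -/
theorem sum_mul_star (hf : IsTraceFrame f) {u : F} (hu : ∀ x, x * u = x) :
    ∑ i, f i * star (f i) = u := by
  refine eq_of_forall_regularTrace_mul_eq fun z => ?_
  rw [hu, Finset.mul_sum, map_sum]
  have h := hf.trace (LinearMap.mul ℂ F z)
  rw [regularTrace, LinearMap.comp_apply, h]
  refine Finset.sum_congr rfl fun i _ => ?_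
  rw [← mul_assoc, regularTrace_mul_comm]
  rfl

end IsTraceFrame

end RegularTrace

/-! ### Quadratic forms of completely positive maps. -/

section CompletelyPositive

theorem CStarAlgebra.exists_eq_star_mul_self {A : Type*} [NonUnitalCStarAlgebra A] [PartialOrder A]
    [StarOrderedRing A] {a : A} (ha : 0 ≤ a) : ∃ b, a = star b * b :=
  CStarAlgebra.nonneg_iff_eq_star_mul_self.1 ha

/-- With `M = R* R` the form is a sum of squares, one for each row of `R`. -/
theorem CStarMatrix.sum_star_mul_mul_nonneg {A : Type*} [NonUnitalCStarAlgebra A] [PartialOrder A]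
    [StarOrderedRing A] {n : Type*} [Fintype n] {M : CStarMatrix n n A} (hM : 0 ≤ M) (v : n → A) :
    0 ≤ ∑ i, ∑ j, star (v i) * M i j * v j := by
  obtain ⟨R, rfl⟩ := CStarAlgebra.exists_eq_star_mul_self hM
  have : ∑ i, ∑ j, star (v i) * (star R * R) i j * v j =
      ∑ k, star (∑ i, R k i * v i) * ∑ j, R k j * v j := by
    simp only [CStarMatrix.mul_apply, CStarMatrix.star_apply, star_sum, star_mul, Finset.sum_mul,
      Finset.mul_sum]
    conv_lhs => enter [2, i]; rw [Finset.sum_comm]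
    rw [Finset.sum_comm]
    refine Finset.sum_congr rfl fun k _ => ?_
    rw [Finset.sum_comm]
    refine Finset.sum_congr rfl fun j _ => Finset.sum_congr rfl fun i _ => ?_
    simp only [mul_assoc]
  rw [this]
  exact Finset.sum_nonneg fun k _ => star_mul_self_nonneg _

theorem CStarMatrix.star_mul_nonneg {A : Type*} [NonUnitalCStarAlgebra A] [PartialOrder A]
    [StarOrderedRing A] {n : Type*} [Fintype n] [Nonempty n] (x : n → A) :
    0 ≤ (CStarMatrix.ofMatrix (Matrix.of fun i j => star (x i) * x j) : CStarMatrix n n A) := by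
  classical
  obtain ⟨o⟩ := ‹Nonempty n›
  let R : CStarMatrix n n A := CStarMatrix.ofMatrix (Matrix.of fun i j => if i = o then x j else 0)
  convert star_mul_self_nonneg R using 1
  ext i j
  simp [R, CStarMatrix.mul_apply, CStarMatrix.star_apply]

variable {F A : Type*} [NonUnitalCStarAlgebra F] [PartialOrder F] [StarOrderedRing F]
  [NonUnitalCStarAlgebra A] [PartialOrder A] [StarOrderedRing A]

theorem CompletelyPositiveMap.sum_star_mul_mul_nonneg (φ : F →CP A) {n : Type*} [Fintype n]
    [Nonempty n] (x : n → F) (v : n → A) :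
    0 ≤ ∑ i, ∑ j, star (v i) * φ (star (x i) * x j) * v j := by
  have := CStarMatrix.sum_star_mul_mul_nonneg
    (φ.map_cstarMatrix_nonneg _ (CStarMatrix.star_mul_nonneg x)) v
  simpa using this

end CompletelyPositive

/-! ### Multiplicativity of order-zero maps up to the factor `φ 1`. -/

section OrderZero

variable {F A : Type u} [NonUnitalCStarAlgebra F] [PartialOrder F] [StarOrderedRing F]
  [NonUnitalCStarAlgebra A] [PartialOrder A] [StarOrderedRing A]
  {φ : F →CP A}

namespace StrictOrderLE

theorem map_mul_map_eq_zero_of_isMinimalProjection (hφ : StrictOrderLE φ 0) {e f : F}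
    (he : IsMinimalProjection e) (hf : IsMinimalProjection f) (hef : e * f = 0) :
    φ e * φ f = 0 := by
  have hfe : f * e = 0 := by
    have := congrArg star hef
    rwa [star_mul, he.1.isSelfAdjoint.star_eq, hf.1.isSelfAdjoint.star_eq, star_zero] at this
  have hse : star (φ e) = φ e := by rw [← map_star, he.1.isSelfAdjoint.star_eq]
  have hsf : star (φ f) = φ f := by rw [← map_star, hf.1.isSelfAdjoint.star_eq]
  -- For `n = 0` elementary sets have two members. If the definition returns `i = j`, a self-adjoint
  -- element has square zero and so vanishes, which settles this case too.
  obtain ⟨i, j, hij⟩ := hφ 2 (by norm_num) ![e, f] ⟨by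
    intro i; fin_cases i
    · exact he
    · exact hf, by
    intro i j h
    fin_cases i <;> fin_cases j <;> simp_all⟩
  fin_cases i <;> fin_cases j
  · have : φ e = 0 := by
      rw [← CStarRing.star_mul_self_eq_zero_iff, hse]; exact hij
    rw [this, zero_mul]
  · exact hij
  · have := congrArg star hij
    simp only [star_mul, star_zero] at this
    rwa [← hse, ← hsf]
  · have : φ f = 0 := by
      rw [← CStarRing.star_mul_self_eq_zero_iff, hsf]; exact hij
    rw [this, mul_zero]

variable [FiniteDimensional ℂ F]

/-- Minimal projections below `e` are orthogonal to those below `f`, and they span `e` and `f`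
respectively. -/
theorem map_mul_map_eq_zero (hφ : StrictOrderLE φ 0) {e f : F}
    (he : IsStarProjection e) (hf : IsStarProjection f) (hef : e * f = 0) :
    φ e * φ f = 0 := by
  have h1 : ∀ e' : F, IsMinimalProjection e' → e' ≤ e → φ e' * φ f = 0 := by
    intro e' he' hle
    have key : ∀ z ∈ Submodule.span ℂ {f' : F | IsMinimalProjection f' ∧ f' ≤ f},
        φ e' * φ z = 0 := by
      intro z hz
      induction hz using Submodule.span_induction with
      | mem f' hf' =>
        refine hφ.map_mul_map_eq_zero_of_isMinimalProjection he' hf'.1 ?_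
        rw [← (he'.1.le_iff_mul_eq_left he).1 hle, ← (hf'.1.1.le_iff_mul_eq_right hf).1 hf'.2,
          mul_assoc, ← mul_assoc e f, hef, zero_mul, mul_zero]
      | zero => simp
      | add x y _ _ hx hy => rw [map_add, mul_add, hx, hy, add_zero]
      | smul c x _ hx => rw [map_smul, mul_smul_comm, hx, smul_zero]
    exact key f hf.mem_span_isMinimalProjection
  have key : ∀ z ∈ Submodule.span ℂ {e' : F | IsMinimalProjection e' ∧ e' ≤ e},
      φ z * φ f = 0 := by
    intro z hz
    induction hz using Submodule.span_induction with
    | mem e' he' => exact h1 e' he'.1 he'.2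
    | zero => simp
    | add x y _ _ hx hy => rw [map_add, add_mul, hx, hy, add_zero]
    | smul c x _ hx => rw [map_smul, smul_mul_assoc, hx, smul_zero]
  exact key e he.mem_span_isMinimalProjection

variable {u : F}

/-- Orthogonality of `e` and `u - e` is preserved, on both sides. -/
theorem map_mul_map_self (hφ : StrictOrderLE φ 0) (hu : IsStarProjection u)
    (hu1 : ∀ x, u * x = x ∧ x * u = x) {e : F} (he : IsStarProjection e) :
    φ u * φ e = φ e * φ e ∧ φ e * φ u = φ e * φ e := by
  have heu : e ≤ u := (he.le_iff_mul_eq_right hu).2 (hu1 e).1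
  have hc : IsStarProjection (u - e) := (he.le_iff_sub hu).1 heu
  have h1 := hφ.map_mul_map_eq_zero he hc (by rw [mul_sub, (hu1 e).2, he.isIdempotentElem.eq, sub_self])
  have h2 := hφ.map_mul_map_eq_zero hc he (by rw [sub_mul, (hu1 e).1, he.isIdempotentElem.eq, sub_self])
  rw [map_sub, mul_sub, sub_eq_zero] at h1
  rw [map_sub, sub_mul, sub_eq_zero] at h2
  exact ⟨h2, h1⟩

theorem commute_map_unit (hφ : StrictOrderLE φ 0) (hu : IsStarProjection u)
    (hu1 : ∀ x, u * x = x ∧ x * u = x) (x : F) : Commute (φ u) (φ x) := by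
  have hx : x ∈ Submodule.span ℂ {e : F | IsStarProjection e} := by
    rw [span_isStarProjection_eq_top]; trivial
  induction hx using Submodule.span_induction with
  | mem e he =>
    have := hφ.map_mul_map_self hu hu1 he
    exact this.1.trans this.2.symm
  | zero => simp
  | add x y _ _ hx hy => rw [map_add]; exact hx.add_right hy
  | smul c x _ hx => rw [map_smul]; exact hx.smul_right c

theorem map_mul_map_of_isSelfAdjoint (hφ : StrictOrderLE φ 0) (hu : IsStarProjection u)
    (hu1 : ∀ x, u * x = x ∧ x * u = x) {a : F} (ha : IsSelfAdjoint a) :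
    φ a * φ a = φ u * φ (a * a) := by
  obtain ⟨s, e, -, he, horth, rfl⟩ := ha.exists_spectral_decomposition
  have hsm (t : ℝ) (x : F) : φ (t • x) = t • φ x := by
    rw [← Complex.coe_smul t x, map_smul, Complex.coe_smul]
  simp only [map_sum, Finset.sum_mul, Finset.mul_sum, hsm, smul_mul_assoc, mul_smul_comm]
  refine Finset.sum_congr rfl fun t _ => ?_
  congr 1
  refine Finset.sum_congr rfl fun r _ => ?_
  congr 1
  by_cases h : r = t
  · subst h
    rw [(he r).isIdempotentElem.eq, (hφ.map_mul_map_self hu hu1 (he r)).1]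
  · rw [horth r t h, hφ.map_mul_map_eq_zero (he r) (he t) (horth r t h), map_zero, mul_zero]

/-- The commutator terms of the real and imaginary parts cancel in the symmetrized product, so the
identity for squares of self-adjoint elements suffices. -/
theorem map_star_mul_map_add (hφ : StrictOrderLE φ 0) (hu : IsStarProjection u)
    (hu1 : ∀ x, u * x = x ∧ x * u = x) (x : F) :
    φ (star x) * φ x + φ x * φ (star x) = φ u * φ (star x * x + x * star x) := by
  have ha : IsSelfAdjoint (realPart x : F) := (realPart x).2
  have hb : IsSelfAdjoint (imaginaryPart x : F) := (imaginaryPart x).2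
  have h1 := hφ.map_mul_map_of_isSelfAdjoint hu hu1 ha
  have h2 := hφ.map_mul_map_of_isSelfAdjoint hu hu1 hb
  have hx := realPart_add_I_smul_imaginaryPart x
  set a : F := (realPart x : F)
  set b : F := (imaginaryPart x : F)
  have hsx : star x = a - Complex.I • b := by
    rw [← hx, star_add, star_smul, ha.star_eq, hb.star_eq]; simp [sub_eq_add_neg]
  have e1 : star x * x + x * star x = (2 : ℂ) • (a * a) + (2 : ℂ) • (b * b) := by
    rw [hsx, ← hx]
    simp only [mul_add, add_mul, sub_mul, mul_sub, smul_mul_assoc, mul_smul_comm]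
    match_scalars <;> ring_nf <;> simp
  have e2 : φ (star x) * φ x + φ x * φ (star x) = (2 : ℂ) • (φ a * φ a) + (2 : ℂ) • (φ b * φ b) := by
    rw [hsx, ← hx]
    simp only [map_add, map_sub, map_smul, mul_add, add_mul, sub_mul, mul_sub, smul_mul_assoc,
      mul_smul_comm]
    match_scalars <;> ring_nf <;> simp
  rw [e1, e2, h1, h2]
  simp only [map_add, map_smul, mul_add, mul_smul_comm]

/-- The symmetrized identity is split by 2-positivity. Put `h = φ u` and let `d x` be the difference
of the two sides. A Schwarz inequality gives `h * d x ≥ 0`, while `d x + d (star x) = 0`; hence `h *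
d x = 0`. The symmetrized identity, compressed by `d x`, then gives `φ x * d x = 0`, and both terms
of `d x * d x` vanish. -/
theorem map_star_mul_map_self (hφ : StrictOrderLE φ 0) (hu : IsStarProjection u)
    (hu1 : ∀ x, u * x = x ∧ x * u = x) (x : F) :
    φ (star x) * φ x = φ u * φ (star x * x) := by
  have hc (z) := hφ.commute_map_unit hu hu1 z
  have hhs : star (φ u) = φ u := by rw [← map_star, hu.isSelfAdjoint.star_eq]
  have hpos (x : F) : 0 ≤ φ u * (φ u * φ (star x * x) - φ (star x) * φ x) := by
    -- This is the Schwarz inequality multiplied through by `φ u`, which need not be invertible.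
    have h := φ.sum_star_mul_mul_nonneg ![u, x] ![-φ x, φ u]
    simp only [Fin.sum_univ_two, Matrix.cons_val_zero, Matrix.cons_val_one, star_neg, hhs,
      hu.isSelfAdjoint.star_eq, (hu1 _).1, (hu1 _).2, ← map_star] at h
    convert h using 1
    have c1 := (hc x).eq
    have c2 := (hc (star x)).eq
    have c3 := (hc (star x * x)).eq
    simp only [mul_sub, neg_mul, mul_neg, neg_neg]
    have e1 : φ (star x) * φ x * φ u = φ u * φ (star x) * φ x := by
      rw [mul_assoc, ← c1, ← mul_assoc, ← c2]
    have e2 : φ u * φ (star x * x) * φ u = φ u * (φ u * φ (star x * x)) := by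
      rw [mul_assoc, ← c3]
    rw [e1, e2, ← c2, ← mul_assoc (φ u) (φ (star x))]
    abel
  set d : F → A := fun x => φ u * φ (star x * x) - φ (star x) * φ x with hd
  have hadd : d x + d (star x) = 0 := by
    have := hφ.map_star_mul_map_add hu hu1 x
    rw [map_add, mul_add] at this
    simp only [hd, star_star]
    rw [sub_add_sub_comm, this, sub_self]
  have hd0 : φ u * d x = 0 := by
    refine le_antisymm ?_ (hpos x)
    rw [eq_neg_of_add_eq_zero_left hadd, mul_neg]
    exact neg_nonpos.2 (hpos (star x))
  have hds : star (d x) = d x := by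
    simp only [hd, star_sub, star_mul, ← map_star, star_star, hu.isSelfAdjoint.star_eq, (hc _).eq]
  have hd0' : d x * φ u = 0 := by
    have := congrArg star hd0
    rwa [star_mul, hds, hhs, star_zero] at this
  have hz : star (φ x * d x) * (φ x * d x) + star (φ (star x) * d x) * (φ (star x) * d x) = 0 := by
    simp only [star_mul, hds, ← map_star, star_star]
    have := hφ.map_star_mul_map_add hu hu1 x
    calc _ = d x * (φ (star x) * φ x + φ x * φ (star x)) * d x := by
          simp only [mul_add, add_mul, mul_assoc]
      _ = 0 := by rw [this, ← mul_assoc, hd0', zero_mul, zero_mul]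
  have hyd : φ x * d x = 0 := by
    rw [← CStarRing.star_mul_self_eq_zero_iff]
    exact ((add_eq_zero_iff_of_nonneg (star_mul_self_nonneg _) (star_mul_self_nonneg _)).1 hz).1
  have hdd : star (d x) * d x = 0 := by
    rw [hds]
    conv_lhs => enter [1]; rw [hd]
    simp only
    rw [sub_mul, mul_assoc (φ (star x)), hyd, mul_zero, sub_zero, (hc _).eq, mul_assoc, hd0, mul_zero]
  exact (sub_eq_zero.1 ((CStarRing.star_mul_self_eq_zero_iff _).1 hdd)).symm

/-- The multiplicativity of a completely positive map of order zero, up to the factor `φ 1`. -/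
theorem map_mul_map (hφ : StrictOrderLE φ 0) (hu : IsStarProjection u)
    (hu1 : ∀ x, u * x = x ∧ x * u = x) (x y : F) :
    φ x * φ y = φ u * φ (x * y) := by
  -- `B` is sesquilinear and vanishes on the diagonal; polarize with `x + y` and `x + I • y`.
  set B : F → F → A := fun x y => φ (star x) * φ y - φ u * φ (star x * y) with hB
  have h0 (x) : B x x = 0 := by
    simp only [hB, hφ.map_star_mul_map_self hu hu1, sub_self]
  suffices h : ∀ x y, B x y = 0 by
    have := h (star x) y
    simpa only [hB, star_star, sub_eq_zero] using this
  intro x y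
  have h1 : B x y + B y x = 0 := by
    have := h0 (x + y)
    have hx := h0 x
    have hy := h0 y
    simp only [hB, star_add, map_add, mul_add, add_mul] at this hx hy ⊢
    linear_combination (norm := abel) this - hx - hy
  have h2 : B x y - B y x = 0 := by
    have := h0 (x + Complex.I • y)
    have hx := h0 x
    have hy := h0 y
    simp only [hB, star_add, star_smul, map_add, map_smul, mul_add, add_mul, smul_mul_assoc,
      mul_smul_comm, Complex.star_def, Complex.conj_I] at this hx hy ⊢
    have h3 : Complex.I • (B x y - B y x) = 0 := by
      simp only [hB]
      linear_combination (norm := skip) this - hx - hy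
      match_scalars <;> ring_nf <;> simp
    exact (smul_eq_zero.1 h3).resolve_left Complex.I_ne_zero
  have h3 : (2 : ℂ) • B x y = 0 := by
    linear_combination (norm := module) h1 + h2
  exact (smul_eq_zero.1 h3).resolve_left two_ne_zero

end StrictOrderLE

end OrderZero

/-! ### Functional calculus: inverting almost idempotents, spectral projections. -/

section FunctionalCalculus

/-- If `t² - t³` is small on `[0, 1]` then `t` is close to `0` or to `1`. -/
theorem le_or_one_sub_le_of_sq_sub_cube_le {t μ : ℝ} (hμ : 0 < μ) (h0 : 0 ≤ t)
    (h1 : t ≤ 1) (h : t * t - t * t * t ≤ μ ^ 2 / 2) :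
    (t < 1 / 2 ∧ t ≤ μ) ∨ (1 / 2 ≤ t ∧ 1 - t ≤ 2 * μ ^ 2) := by
  rcases lt_or_ge t (1 / 2) with ht2 | ht2
  · have h3 : t * t ≤ μ ^ 2 := by
      nlinarith [mul_nonneg (mul_self_nonneg t) (by linarith : 0 ≤ 1 / 2 - t)]
    exact Or.inl ⟨ht2, by nlinarith⟩
  · refine Or.inr ⟨ht2, ?_⟩
    nlinarith [mul_nonneg (by nlinarith : 0 ≤ t * t - 1 / 4) (by linarith : 0 ≤ 1 - t)]

/-- If `g` is close to being idempotent in the sense that `g² - g³` is small, then there is an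
element `k` that inverts `g` on the part of the spectrum close to `1` and vanishes on the rest. -/
theorem exists_partial_inverse {A : Type*} [NonUnitalCStarAlgebra A] [PartialOrder A]
    [StarOrderedRing A] {g : A} {μ : ℝ} (hg : 0 ≤ g) (hg1 : ‖g‖ ≤ 1) (hμ : 0 < μ) (hμ' : μ ≤ 1 / 4)
    (h : ‖g * g - g * g * g‖ ≤ μ ^ 2 / 2) :
    ∃ k : A, star k = k ∧ (∀ y, Commute g y → Commute k y) ∧ k * k * g = k ∧
      ‖g - k * g - k * g + k‖ ≤ μ := by
  have hgs : IsSelfAdjoint g := .of_nonneg hg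
  -- The cut-off `c` is `0` up to `3/8` and `1` from `5/8` on. The spectrum lies in `[0, 1/4] ∪
  -- [7/8, 1]`, because `μ ≤ 1/4` and `2μ² ≤ 1/8`. So `κ` is `0` on the first part and `1/t` on the
  -- second, the maximum with `1/4` only keeping it continuous.
  let c : ℝ → ℝ := fun t => max 0 (min 1 (4 * t - 3 / 2))
  let κ : ℝ → ℝ := fun t => c t * (max t (1 / 4))⁻¹
  have hκc : Continuous κ := by
    refine Continuous.mul (by fun_prop) (Continuous.inv₀ (by fun_prop) fun t => ?_)
    have : (1 / 4 : ℝ) ≤ max t (1 / 4) := le_max_right _ _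
    linarith
  have hκ0 : κ 0 = 0 := by norm_num [κ, c]
  have hid : cfcₙ (fun t : ℝ => t) g = g := cfcₙ_id' ℝ g
  have hgg : cfcₙ (fun t : ℝ => t * t - t * t * t) g = g * g - g * g * g := by
    rw [cfcₙ_sub (fun t : ℝ => t * t) (fun t => t * t * t) g,
      cfcₙ_mul (fun t : ℝ => t * t) (fun t => t) g, cfcₙ_mul (fun t : ℝ => t) (fun t => t) g, hid]
  have hspec : ∀ t ∈ quasispectrum ℝ g, 0 ≤ t ∧ t ≤ 1 ∧ t * t - t * t * t ≤ μ ^ 2 / 2 := by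
    intro t ht
    have h0 := quasispectrum_nonneg_of_nonneg g hg t ht
    have h1 := norm_apply_le_norm_cfcₙ (fun t : ℝ => t) g ht
    have h2 := norm_apply_le_norm_cfcₙ (fun t : ℝ => t * t - t * t * t) g ht
    rw [hid] at h1
    rw [hgg] at h2
    exact ⟨h0, (le_abs_self t).trans (h1.trans hg1), (le_abs_self _).trans (h2.trans h)⟩
  have hval : ∀ t ∈ quasispectrum ℝ g, (κ t = 0 ∧ t ≤ μ) ∨ (κ t = t⁻¹ ∧ 1 - t ≤ 2 * μ ^ 2 ∧ 1 / 2 ≤ t) := by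
    intro t ht
    obtain ⟨h0, h1, h2⟩ := hspec t ht
    rcases le_or_one_sub_le_of_sq_sub_cube_le hμ h0 h1 h2 with ⟨ht2, h4⟩ | ⟨ht2, h3⟩
    · refine Or.inl ⟨?_, h4⟩
      have : c t = 0 := max_eq_left ((min_le_right _ _).trans (by linarith))
      simp [κ, this]
    · refine Or.inr ⟨?_, h3, ht2⟩
      have h6 : μ ^ 2 ≤ 1 / 16 := by nlinarith
      have h5 : c t = 1 := by
        simp only [c]
        rw [min_eq_left (by linarith)]; simp
      simp only [κ, h5, one_mul]
      rw [max_eq_left (by linarith)]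
  refine ⟨cfcₙ κ g, (cfcₙ_predicate κ g : IsSelfAdjoint _).star_eq,
    fun y hy => hy.cfcₙ_real κ, ?_, ?_⟩
  · have h1 : cfcₙ κ g * cfcₙ κ g * g = cfcₙ (fun t => κ t * κ t * t) g := by
      rw [cfcₙ_mul (fun t => κ t * κ t) (fun t => t) g (hκc.mul hκc).continuousOn (by rw [hκ0, mul_zero])
        continuousOn_id rfl, cfcₙ_mul κ κ g hκc.continuousOn hκ0 hκc.continuousOn hκ0, hid]
    rw [h1]
    refine cfcₙ_congr fun t ht => ?_
    rcases hval t ht with h1 | h1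
    · simp [h1.1]
    · have : t ≠ 0 := by linarith [h1.2.2]
      simp only [h1.1]
      field_simp
  -- Since `k² g = k`, this expression is `g (1 - k)²`, the form in which the error appears later.
  · have h1 : g - cfcₙ κ g * g - cfcₙ κ g * g + cfcₙ κ g =
        cfcₙ (fun t => t - κ t * t - κ t * t + κ t) g := by
      have c1 : Continuous fun t => κ t * t := hκc.mul continuous_id
      have z1 : (fun t => κ t * t) 0 = 0 := mul_zero _
      rw [cfcₙ_add (fun t => t - κ t * t - κ t * t) κ g
          ((continuous_id.sub c1).sub c1).continuousOn (by simp) hκc.continuousOn hκ0,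
        cfcₙ_sub (fun t => t - κ t * t) (fun t => κ t * t) g (continuous_id.sub c1).continuousOn
          (by simp) c1.continuousOn z1,
        cfcₙ_sub (fun t => t) (fun t => κ t * t) g continuousOn_id rfl c1.continuousOn z1,
        cfcₙ_mul κ (fun t => t) g hκc.continuousOn hκ0 continuousOn_id rfl, hid]
    rw [h1]
    refine norm_cfcₙ_le fun t ht => ?_
    obtain ⟨h0, h2, -⟩ := hspec t ht
    rcases hval t ht with h3 | ⟨h3, h4, h5⟩
    · rw [h3.1, Real.norm_eq_abs, abs_of_nonneg (by linarith)]
      linarith [h3.2]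
    · have ht0 : t ≠ 0 := by linarith
      have : t - κ t * t - κ t * t + κ t = (1 - t) ^ 2 / t := by
        rw [h3]; field_simp; ring
      rw [this, Real.norm_eq_abs, abs_of_nonneg (by positivity), div_le_iff₀ (by linarith)]
      have h6 : 1 - t ≤ μ / 2 := by nlinarith
      have h7 : (1 - t) ^ 2 ≤ (1 - t) * 1 := by rw [sq]; gcongr <;> linarith
      have h8 : μ * (1 / 2) ≤ μ * t := by gcongr
      linarith

variable {F : Type*} [NonUnitalCStarAlgebra F] [FiniteDimensional ℂ F] [PartialOrder F]
  [StarOrderedRing F]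

/-- The spectral projection of `x ≥ 0` for the interval `[δ, ∞)`. -/
theorem exists_spectral_projection {x : F} (hx : 0 ≤ x) {δ : ℝ} (hδ : 0 < δ) :
    ∃ q : F, IsStarProjection q ∧ δ ^ 2 • q ≤ x * x ∧ ‖x - q * x - x * q + q * x * q‖ ≤ δ := by
  classical
  have hxs : IsSelfAdjoint x := .of_nonneg hx
  let χ : ℝ → ℝ := fun t => if δ ≤ t then 1 else 0
  have hχ0 : χ 0 = 0 := by simp [χ, hδ.not_ge]
  have hc (f : ℝ → ℝ) := continuousOn_quasispectrum f x
  have hid : cfcₙ (fun t : ℝ => t) x = x := cfcₙ_id' ℝ x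
  refine ⟨cfcₙ χ x, isStarProjection_cfcₙ _ _ fun t => ?_, ?_, ?_⟩
  · simp only [χ]; split_ifs <;> simp
  · have h1 : δ ^ 2 • cfcₙ χ x = cfcₙ (fun t => δ ^ 2 * χ t) x :=
      (cfcₙ_const_mul _ χ x (hc _) hχ0).symm
    have h2 : x * x = cfcₙ (fun t : ℝ => t * t) x := by
      rw [cfcₙ_mul (fun t : ℝ => t) (fun t => t) x, hid]
    rw [h1, h2]
    refine cfcₙ_mono (fun t _ => ?_) (hc _) (hc _) (by simp [hχ0]) (by simp)
    simp only [χ]; split_ifs with h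
    · nlinarith
    · nlinarith [mul_self_nonneg t]
  -- This is the corner `(1 - q) x (1 - q)`, written without a unit.
  · have h1 : x - cfcₙ χ x * x - x * cfcₙ χ x + cfcₙ χ x * x * cfcₙ χ x =
        cfcₙ (fun t => t - χ t * t - t * χ t + χ t * t * χ t) x := by
      have z1 : (fun t => χ t * t) 0 = 0 := mul_zero _
      have z2 : (fun t => t * χ t) 0 = 0 := zero_mul _
      rw [cfcₙ_add (fun t => t - χ t * t - t * χ t) (fun t => χ t * t * χ t) x (hc _) (by simp)
          (hc _) (by simp),
        cfcₙ_sub (fun t => t - χ t * t) (fun t => t * χ t) x (hc _) (by simp) (hc _) z2,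
        cfcₙ_sub (fun t => t) (fun t => χ t * t) x (hc _) rfl (hc _) z1,
        cfcₙ_mul (fun t => χ t * t) χ x (hc _) z1 (hc _) hχ0,
        cfcₙ_mul χ (fun t => t) x (hc _) hχ0 (hc _) rfl,
        cfcₙ_mul (fun t => t) χ x (hc _) rfl (hc _) hχ0, hid]
    rw [h1]
    refine norm_cfcₙ_le fun t ht => ?_
    have h0 := quasispectrum_nonneg_of_nonneg x hx t ht
    simp only [χ]; split_ifs with h
    · simp [hδ.le]
    · simp only [zero_mul, mul_zero, sub_zero, add_zero, Real.norm_eq_abs, abs_of_nonneg h0]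
      linarith

end FunctionalCalculus

/-! ### Compressing positive elements by a projection. -/

section Compression

variable {F : Type*} [NonUnitalCStarAlgebra F] [PartialOrder F]
  [StarOrderedRing F]

/-- If the corner of `x` complementary to the projection `q` is small then every positive
contraction below `x` is close to its compression by `q`. -/
theorem norm_sub_compression_le {q x y u : F} (hq : IsStarProjection q) (hu : IsStarProjection u)
    (hu1 : ∀ x, u * x = x ∧ x * u = x) (hy : 0 ≤ y) (hyx : y ≤ x) (hy1 : ‖y‖ ≤ 1) {δ : ℝ}
    (h : ‖x - q * x - x * q + q * x * q‖ ≤ δ ^ 2) (hδ : 0 ≤ δ) :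
    ‖y - q * y * q‖ ≤ 2 * δ := by
  obtain ⟨w, hw, hwy⟩ := CStarAlgebra.nonneg_iff_exists_nonneg_and_eq_mul_self.1 hy
  have hws : star w = w := (IsSelfAdjoint.of_nonneg hw).star_eq
  have hqs : star q = q := hq.isSelfAdjoint.star_eq
  set c := u - q with hc
  have hcs : star c = c := by rw [hc, star_sub, hu.isSelfAdjoint.star_eq, hqs]
  have hcx : c * x * c = x - q * x - x * q + q * x * q := by
    simp only [hc, sub_mul, mul_sub, hu1]
    abel
  have hcyx : c * y * c ≤ c * x * c := by
    have := star_left_conjugate_le_conjugate hyx c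
    rwa [hcs] at this
  have hcy0 : 0 ≤ c * y * c := by
    have := star_left_conjugate_nonneg hy c
    rwa [hcs] at this
  -- With `y = w²` one has `‖c w‖² = ‖c y c‖ ≤ ‖c x c‖`. The square root taken here is why the
  -- hypothesis involves `δ²`.
  have h1 : ‖c * w‖ * ‖c * w‖ ≤ δ ^ 2 := by
    rw [← CStarRing.norm_self_mul_star, star_mul, hws, hcs]
    calc _ = ‖c * y * c‖ := by rw [hwy]; simp only [mul_assoc]
      _ ≤ ‖c * x * c‖ := CStarAlgebra.norm_le_norm_of_nonneg_of_le hcy0 hcyx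
      _ ≤ δ ^ 2 := by rw [hcx]; exact h
  have h2 : ‖c * w‖ ≤ δ := by nlinarith [norm_nonneg (c * w)]
  have h3 : ‖w‖ ≤ 1 := by
    have : ‖w‖ * ‖w‖ ≤ 1 := by rw [← CStarRing.norm_self_mul_star, hws, ← hwy]; exact hy1
    nlinarith [norm_nonneg w]
  have h4 : ‖c * y‖ ≤ δ := by
    rw [hwy, ← mul_assoc]
    exact (norm_mul_le _ _).trans (by nlinarith [norm_nonneg (c * w), norm_nonneg w])
  have h5 : ‖y * c‖ ≤ δ := by
    rw [← norm_star, star_mul, hcs, (IsSelfAdjoint.of_nonneg hy).star_eq]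
    exact h4
  have h6 : y - q * y * q = c * y + q * (y * c) := by
    simp only [hc, sub_mul, mul_sub, hu1, mul_assoc]
    abel
  rw [h6]
  calc _ ≤ ‖c * y‖ + ‖q‖ * ‖y * c‖ := (norm_add_le _ _).trans (by gcongr; exact norm_mul_le _ _)
    _ ≤ δ + 1 * δ := by gcongr; exact hq.norm_le
    _ = 2 * δ := by ring

end Compression

/-! ### From an order-zero map to a nearby *-homomorphism on a corner. -/

section OrderZero

variable {F A : Type u} [NonUnitalCStarAlgebra F] [PartialOrder F] [StarOrderedRing F]
  [FiniteDimensional ℂ F] [NonUnitalCStarAlgebra A] [PartialOrder A] [StarOrderedRing A]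
  {φ : F →CP A} {u : F}

namespace StrictOrderLE

/-- For `z = b* b` and `h = φ u`, multiplicativity gives `h² φ z = (φ b)* h (φ b)`. This is
positive, and for `‖h‖ ≤ 1` it lies below `(φ b)* (φ b) = h φ z`, which is the next lemma. -/
theorem map_unit_mul_nonneg (hφ : StrictOrderLE φ 0) (hu : IsStarProjection u)
    (hu1 : ∀ x, u * x = x ∧ x * u = x) {z : F} (hz : 0 ≤ z) :
    0 ≤ φ u * (φ u * φ z) := by
  obtain ⟨b, rfl⟩ := CStarAlgebra.exists_eq_star_mul_self hz
  have h : φ u * (φ u * φ (star b * b)) = star (φ b) * φ u * φ b := by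
    rw [← map_star, ← hφ.map_mul_map hu hu1, ← mul_assoc, (hφ.commute_map_unit hu hu1 _).eq]
  rw [h]
  exact star_left_conjugate_nonneg (map_nonneg φ hu.nonneg) _

theorem map_unit_mul_le (hφ : StrictOrderLE φ 0) (hu : IsStarProjection u)
    (hu1 : ∀ x, u * x = x ∧ x * u = x) (hφu : ‖φ u‖ ≤ 1) {z : F} (hz : 0 ≤ z) :
    φ u * (φ u * φ z) ≤ φ u * φ z := by
  obtain ⟨b, rfl⟩ := CStarAlgebra.exists_eq_star_mul_self hz
  have h : φ u * (φ u * φ (star b * b)) = star (φ b) * φ u * φ b := by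
    rw [← map_star, ← hφ.map_mul_map hu hu1, ← mul_assoc, (hφ.commute_map_unit hu hu1 _).eq]
  rw [h, ← hφ.map_mul_map hu hu1, map_star]
  refine (CStarAlgebra.star_left_conjugate_le_norm_smul
    (IsSelfAdjoint.of_nonneg (map_nonneg φ hu.nonneg))).trans ?_
  calc _ ≤ (1 : ℝ) • (star (φ b) * φ b) := by
        gcongr
        exact star_mul_self_nonneg _
    _ = _ := one_smul _ _

/-- If `φ x` acts almost as a unit on `φ y` then the spectral projections of `y` for intervals
away from `0` are mapped to almost idempotent elements. -/
theorem norm_map_projection_sub_le (hφ : StrictOrderLE φ 0) (hu : IsStarProjection u)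
    (hu1 : ∀ x, u * x = x ∧ x * u = x) (hφu : ‖φ u‖ ≤ 1) {x y q : F} (hx : 0 ≤ x) (hx1 : ‖x‖ ≤ 1)
    (hy : 0 ≤ y) (hφy : ‖φ y‖ ≤ 1) (hq : IsStarProjection q) {δ η : ℝ} (hδ : 0 < δ)
    (hqy : δ ^ 2 • q ≤ y * y) (h : ‖φ x * φ y - φ y‖ ≤ η) :
    ‖φ q * φ q - φ q * φ q * φ q‖ ≤ η / δ ^ 2 := by
  have hmul := hφ.map_mul_map hu hu1
  have hys : star y = y := (IsSelfAdjoint.of_nonneg hy).star_eq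
  have hsm (t : ℝ) (x : F) : φ (t • x) = t • φ x := by
    rw [← Complex.coe_smul t x, map_smul, Complex.coe_smul]
  -- The difference is `-φ y (φ x φ y - φ y)`. As `y x y ≤ y²`, replacing `y x y` by `y²` only
  -- decreases it, so `h φ (y²) - h² φ (y²)` is small, where `h = φ u`.
  have h1 : ‖φ u * φ (y * y) - φ u * (φ u * φ (y * x * y))‖ ≤ η := by
    have e : φ u * φ (y * y) - φ u * (φ u * φ (y * x * y)) = -(φ y * (φ x * φ y - φ y)) := by
      rw [mul_sub, ← hmul, ← hmul (y * x) y, ← mul_assoc, ← hmul, mul_assoc]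
      abel
    rw [e, norm_neg]
    calc _ ≤ ‖φ y‖ * ‖φ x * φ y - φ y‖ := norm_mul_le _ _
      _ ≤ 1 * η := by gcongr
      _ = η := one_mul _
  have hyy : 0 ≤ y * y := by
    nth_rewrite 1 [← hys]
    exact star_mul_self_nonneg _
  have hyx : y * x * y ≤ y * y := by
    have := CStarAlgebra.star_left_conjugate_le_norm_smul (a := y) (IsSelfAdjoint.of_nonneg hx)
    rw [hys] at this
    refine this.trans ?_
    calc _ ≤ (1 : ℝ) • (y * y) := by
          gcongr
      _ = _ := one_smul _ _
  have h2 : φ u * (φ u * φ (y * x * y)) ≤ φ u * (φ u * φ (y * y)) := by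
    have := hφ.map_unit_mul_nonneg hu hu1 (sub_nonneg.2 hyx)
    rw [map_sub, mul_sub, mul_sub] at this
    exact sub_nonneg.1 this
  have h3 : ‖φ u * φ (y * y) - φ u * (φ u * φ (y * y))‖ ≤ η :=
    (CStarAlgebra.norm_le_norm_of_nonneg_of_le
      (sub_nonneg.2 (hφ.map_unit_mul_le hu hu1 hφu hyy)) (sub_le_sub_left h2 _)).trans h1
  -- The map `z ↦ h φ z - h² φ z` is positive, so smallness at `y²` passes to `δ² q ≤ y²`; at `q`
  -- its value is `(φ q)² - (φ q)³`.
  have h4 : δ ^ 2 • (φ u * φ q - φ u * (φ u * φ q)) ≤ φ u * φ (y * y) - φ u * (φ u * φ (y * y)) := by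
    have := hφ.map_unit_mul_le hu hu1 hφu (sub_nonneg.2 hqy)
    rw [map_sub, mul_sub, mul_sub, hsm, mul_smul_comm, mul_smul_comm] at this
    rw [smul_sub]
    rw [← sub_nonneg] at this ⊢
    convert this using 1
    abel
  have h5 : φ q * φ q - φ q * φ q * φ q = φ u * φ q - φ u * (φ u * φ q) := by
    have e : φ q * φ q = φ u * φ q := by rw [hmul, hq.isIdempotentElem.eq]
    rw [e, mul_assoc, e]
  have h6 : 0 ≤ δ ^ 2 • (φ u * φ q - φ u * (φ u * φ q)) :=
    smul_nonneg (sq_nonneg δ) (sub_nonneg.2 (hφ.map_unit_mul_le hu hu1 hφu hq.nonneg))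
  have h7 := (CStarAlgebra.norm_le_norm_of_nonneg_of_le h6 h4).trans h3
  rw [norm_smul, Real.norm_of_nonneg (sq_nonneg δ)] at h7
  rw [h5, le_div_iff₀ (by positivity), mul_comm]
  exact h7

/-- Perturbing a completely positive map of order zero, compressed by a projection `q` for which
`φ q` is almost idempotent, to a *-homomorphism. -/
theorem exists_finiteDimensional_subalgebra (hφ : StrictOrderLE φ 0) (hu : IsStarProjection u)
    (hu1 : ∀ x, u * x = x ∧ x * u = x) (hφc : ∀ x, ‖φ x‖ ≤ ‖x‖) {q : F}
    (hq : IsStarProjection q) {μ : ℝ} (hμ : 0 < μ) (hμ' : μ ≤ 1 / 4)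
    (h : ‖φ q * φ q - φ q * φ q * φ q‖ ≤ μ ^ 2 / 2) :
    ∃ B : NonUnitalStarSubalgebra ℂ A, FiniteDimensional ℂ B ∧
      ∀ x, ∃ b ∈ B, ‖φ (q * x * q) - b‖ * ‖φ (q * x * q) - b‖ ≤ μ * (‖x‖ * ‖x‖) := by
  have hmul := hφ.map_mul_map hu hu1
  have hqn : ‖q‖ ≤ 1 := hq.norm_le
  have hqq (z : F) : q * (q * z) = q * z := by rw [← mul_assoc, hq.isIdempotentElem.eq]
  obtain ⟨k, hks, hkc, hkk, hkn⟩ := exists_partial_inverse (map_nonneg φ hq.nonneg)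
    ((hφc q).trans hqn) hμ hμ' h
  have hgl (x : F) : φ q * φ (q * x) = φ u * φ (q * x) := by rw [hmul, hqq]
  have hgr (x : F) : φ (x * q) * φ q = φ u * φ (x * q) := by
    rw [hmul, mul_assoc, hq.isIdempotentElem.eq]
  have hgc (x : F) : Commute (φ q) (φ (q * x * q)) := by
    have h1 := hgl (x * q)
    have h2 := hgr (q * x)
    rw [← mul_assoc] at h1
    exact h1.trans h2.symm
  have hkx (x : F) : Commute k (φ (q * x * q)) := hkc _ (hgc x)
  -- On `qFq` the factor `φ u` acts as `φ q`, so `k² φ q = k` makes `x ↦ k φ (q x q)` multiplicative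
  -- on that corner.
  let L : F →ₗ[ℂ] A := LinearMap.mul ℂ A k ∘ₗ (φ : F →ₗ[ℂ] A) ∘ₗ
    LinearMap.mulRight ℂ q ∘ₗ LinearMap.mulLeft ℂ q
  have hL (x) : L x = k * φ (q * x * q) := rfl
  have hLmul (x y) : L x * L y = L (x * q * y) := by
    have e : q * x * q * (q * y * q) = q * (x * q * y) * q := by
      simp only [mul_assoc, hqq]
    have e2 : φ u * φ (q * (x * q * y) * q) = φ q * φ (q * (x * q * y) * q) := by
      rw [mul_assoc q, hgl]
    calc k * φ (q * x * q) * (k * φ (q * y * q))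
        = k * (φ (q * x * q) * k) * φ (q * y * q) := by simp only [mul_assoc]
      _ = k * k * (φ (q * x * q) * φ (q * y * q)) := by rw [← (hkx x).eq]; simp only [mul_assoc]
      _ = k * k * φ q * φ (q * (x * q * y) * q) := by rw [hmul, e, e2]; simp only [mul_assoc]
      _ = L (x * q * y) := by rw [hkk, hL]
  have hLstar (x) : star (L x) = L (star x) := by
    rw [hL, hL, star_mul, hks, ← map_star, (hkx _).eq]
    simp only [star_mul, hq.isSelfAdjoint.star_eq, mul_assoc]
  let B : NonUnitalStarSubalgebra ℂ A :=
    { LinearMap.range L with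
      mul_mem' := by
        rintro _ _ ⟨x, rfl⟩ ⟨y, rfl⟩
        exact ⟨_, (hLmul x y).symm⟩
      star_mem' := by
        rintro _ ⟨x, rfl⟩
        exact ⟨_, (hLstar x).symm⟩ }
  refine ⟨B, inferInstanceAs (FiniteDimensional ℂ (LinearMap.range L)), fun x =>
    ⟨L x, ⟨x, rfl⟩, ?_⟩⟩
  rw [← CStarRing.norm_self_mul_star, hL]
  set y := q * x * q with hy
  have hys : φ y * star (φ y) = φ q * φ (y * star y) := by
    rw [← map_star, hmul, hy, mul_assoc q, mul_assoc q, hgl]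
  have hc2 : Commute k (φ (y * star y)) := by
    have : y * star y = q * (x * q * star x) * q := by
      simp only [hy, star_mul, hq.isSelfAdjoint.star_eq, mul_assoc, hqq]
    rw [this]; exact hkx _
  -- With `g = φ q` the squared error is `g (1 - k)² φ (y y*)`, to which the norm bound on `k`
  -- applies.
  have e : (φ y - k * φ y) * star (φ y - k * φ y) =
      (φ q - k * φ q - k * φ q + k) * φ (y * star y) := by
    have hgk : φ q * k = k * φ q := (hkc _ (Commute.refl _)).eq.symm
    rw [star_sub, star_mul, hks]
    have e1 : (φ y - k * φ y) * (star (φ y) - star (φ y) * k) = φ y * star (φ y) - k * (φ y * star (φ y))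
      - φ y * star (φ y) * k + k * (φ y * star (φ y)) * k := by
      simp only [sub_mul, mul_sub, mul_assoc]; abel
    rw [e1, hys, mul_assoc (φ q), ← hc2.eq, ← mul_assoc (φ q), hgk, mul_assoc k (φ q * _) k,
      mul_assoc (φ q) _ k, ← hc2.eq, ← mul_assoc (φ q), hgk, ← mul_assoc k (k * φ q), ← mul_assoc k k, hkk]
    simp only [sub_mul, add_mul, mul_assoc]
  rw [e]
  have hyn : ‖y‖ ≤ ‖x‖ := by
    calc ‖y‖ ≤ ‖q‖ * ‖x‖ * ‖q‖ := (norm_mul_le _ _).trans (by gcongr; exact norm_mul_le _ _)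
      _ ≤ 1 * ‖x‖ * 1 := by gcongr
      _ = ‖x‖ := by ring
  calc _ ≤ ‖φ q - k * φ q - k * φ q + k‖ * ‖φ (y * star y)‖ := norm_mul_le _ _
    _ ≤ μ * (‖x‖ * ‖x‖) := by
      gcongr
      refine (hφc _).trans ?_
      rw [CStarRing.norm_self_mul_star]
      gcongr

end StrictOrderLE

end OrderZero

/-! ### Rank zero implies local finite-dimensionality. -/

section LocallyFiniteDimensional

/-- Every finite set is approximately contained in a finite-dimensional C*-subalgebra. -/
def IsLocallyAF (A : Type u) [NonUnitalCStarAlgebra A] : Prop :=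
  ∀ (s : Finset A) (ε : ℝ), 0 < ε → ∃ B : NonUnitalStarSubalgebra ℂ A,
    FiniteDimensional ℂ B ∧ ∀ a ∈ s, ∃ b ∈ B, ‖a - b‖ < ε

variable {A : Type u} [NonUnitalCStarAlgebra A] [PartialOrder A] [StarOrderedRing A]

theorem CPRankLE.exists_factorization {n : ℤ} (h : CPRankLE A n) (s : Finset A) {ε : ℝ}
    (hε : 0 < ε) : ∃ T : CPFactorization A, (∀ a ∈ s, ‖T.φ (T.ψ a) - a‖ < ε) ∧
      StrictOrderLE T.φ n := by
  obtain ⟨T, hT, hT'⟩ := h _ (fun i => (s.equivFin.symm i : A)) ε hε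
  refine ⟨T, fun a ha => ?_, hT'⟩
  simpa using hT (s.equivFin ⟨a, ha⟩)

theorem exists_almost_unit (s : Finset A) {η : ℝ} (hη : 0 < η) :
    ∃ e : A, 0 ≤ e ∧ ‖e‖ ≤ 1 ∧ ∀ a ∈ s, ‖e * a - a‖ < η ∧ ‖a * e - a‖ < η := by
  have hl := CStarAlgebra.increasingApproximateUnit A
  have := hl.neBot
  have h : ∀ᶠ e in CStarAlgebra.approximateUnit A,
      ∀ a ∈ s, ‖e * a - a‖ < η ∧ ‖a * e - a‖ < η := by
    rw [Finset.eventually_all]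
    intro a _
    have h1 := (hl.tendsto_mul_right a).eventually (Metric.ball_mem_nhds a hη)
    have h2 := (hl.tendsto_mul_left a).eventually (Metric.ball_mem_nhds a hη)
    filter_upwards [h1, h2] with e he1 he2
    exact ⟨by simpa [dist_eq_norm] using he1, by simpa [dist_eq_norm] using he2⟩
  obtain ⟨e, h1, h2, h3⟩ := (hl.eventually_nonneg.and (hl.eventually_norm.and h)).exists
  exact ⟨e, h1, h2, h3⟩

theorem CPRankLE.exists_finiteDimensional_of_nonneg (h : CPRankLE A 0) (s : Finset A)
    (hs : ∀ a ∈ s, 0 ≤ a ∧ ‖a‖ ≤ 1) {ε : ℝ} (hε : 0 < ε) (hε1 : ε ≤ 1) :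
    ∃ B : NonUnitalStarSubalgebra ℂ A, FiniteDimensional ℂ B ∧ ∀ a ∈ s, ∃ b ∈ B, ‖a - b‖ < ε := by
  classical
  -- Error budget: at most `2η ≤ ε/8` for replacing `a` by `e' a e'`, `η ≤ ε/16` for the
  -- factorization, `2δ = ε/8` for compression by `q`, and `√μ = ε/8` for the *-homomorphism. The
  -- second bound on `η` makes `φ q` idempotent enough for the chosen `μ`.
  obtain ⟨δ, hδ⟩ : ∃ δ : ℝ, δ = ε / 16 := ⟨_, rfl⟩
  have hδ0 : 0 < δ := by linarith
  obtain ⟨μ, hμ⟩ : ∃ μ : ℝ, μ = (ε / 8) ^ 2 := ⟨_, rfl⟩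
  have hμ0 : 0 < μ := by rw [hμ]; positivity
  have hμ1 : μ ≤ 1 / 4 := by rw [hμ]; nlinarith
  obtain ⟨η, hη⟩ : ∃ η : ℝ, η = min (ε / 16) (μ ^ 2 / 2 * (δ ^ 2) ^ 2 / 4) := ⟨_, rfl⟩
  have hη0 : 0 < η := by rw [hη]; positivity
  have hη1 : η ≤ ε / 16 := by rw [hη]; exact min_le_left _ _
  have hη2 : 4 * η / (δ ^ 2) ^ 2 ≤ μ ^ 2 / 2 := by
    rw [div_le_iff₀ (by positivity)]
    have : η ≤ μ ^ 2 / 2 * (δ ^ 2) ^ 2 / 4 := by rw [hη]; exact min_le_right _ _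
    linarith
  -- Two almost units are needed: `e'` dominates the elements `e' a e'`, and `e` acts almost as a
  -- unit on `e'`.
  obtain ⟨e', he'0, he'1, he'⟩ := exists_almost_unit s hη0
  obtain ⟨e, he0, he1, he⟩ := exists_almost_unit {e'} hη0
  obtain ⟨T, hT, hT0⟩ := h.exists_factorization
    (insert e (insert e' (s.image fun a => e' * a * e'))) hη0
  obtain ⟨u, hu, hu1⟩ := exists_unit_of_finiteDimensional T.F
  have hψe : ‖T.φ (T.ψ e) - e‖ ≤ η := (hT e (by simp)).le
  have hψe' : ‖T.φ (T.ψ e') - e'‖ ≤ η := (hT e' (by simp)).le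
  have hφu : ‖T.φ u‖ ≤ 1 := (T.φ_contractive u).trans hu.norm_le
  have hx1 : ‖T.ψ e‖ ≤ 1 := (T.ψ_contractive e).trans he1
  have hy1 : ‖T.ψ e'‖ ≤ 1 := (T.ψ_contractive e').trans he'1
  have hy2 : ‖T.φ (T.ψ e')‖ ≤ 1 := (T.φ_contractive _).trans hy1
  have hy0 : 0 ≤ T.ψ e' := map_nonneg T.ψ he'0
  obtain ⟨q, hq, hq1, hq2⟩ := exists_spectral_projection hy0 (δ := δ ^ 2) (by positivity)
  have h4 : ‖T.φ (T.ψ e) * T.φ (T.ψ e') - T.φ (T.ψ e')‖ ≤ 4 * η := by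
    have e1 : T.φ (T.ψ e) * T.φ (T.ψ e') - T.φ (T.ψ e') =
        (T.φ (T.ψ e) - e) * T.φ (T.ψ e') + e * (T.φ (T.ψ e') - e') + (e * e' - e') -
          (T.φ (T.ψ e') - e') := by noncomm_ring
    rw [e1]
    have h1 : ‖(T.φ (T.ψ e) - e) * T.φ (T.ψ e')‖ ≤ η * 1 := (norm_mul_le _ _).trans (by gcongr)
    have h2 : ‖e * (T.φ (T.ψ e') - e')‖ ≤ 1 * η := (norm_mul_le _ _).trans (by gcongr)
    have h3 := (he e' (by simp)).1
    refine (norm_sub_le _ _).trans ?_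
    have := norm_add₃_le (a := (T.φ (T.ψ e) - e) * T.φ (T.ψ e'))
      (b := e * (T.φ (T.ψ e') - e')) (c := e * e' - e')
    linarith
  have h5 := hT0.norm_map_projection_sub_le hu hu1 hφu (map_nonneg T.ψ he0) hx1 hy0 hy2 hq
    (by positivity) hq1 h4
  obtain ⟨B, hB, hB'⟩ := hT0.exists_finiteDimensional_subalgebra hu hu1 T.φ_contractive hq hμ0 hμ1
    (h5.trans hη2)
  refine ⟨B, hB, fun a ha => ?_⟩
  obtain ⟨b, hbB, hb⟩ := hB' (T.ψ (e' * a * e'))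
  refine ⟨b, hbB, ?_⟩
  obtain ⟨ha0, ha1⟩ := hs a ha
  have he's : star e' = e' := (IsSelfAdjoint.of_nonneg he'0).star_eq
  have ha'0 : 0 ≤ e' * a * e' := by
    have := star_left_conjugate_nonneg ha0 e'
    rwa [he's] at this
  have ha'1 : e' * a * e' ≤ e' := by
    have h1 := CStarAlgebra.star_left_conjugate_le_norm_smul (a := e') (IsSelfAdjoint.of_nonneg ha0)
    rw [he's] at h1
    obtain ⟨w, hw, hwe⟩ := CStarAlgebra.nonneg_iff_exists_nonneg_and_eq_mul_self.1 he'0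
    have hws : star w = w := (IsSelfAdjoint.of_nonneg hw).star_eq
    have h2 := CStarAlgebra.star_left_conjugate_le_norm_smul (a := w) (IsSelfAdjoint.of_nonneg he'0)
    rw [hws, ← hwe] at h2
    have h3 : w * e' * w = e' * e' := by rw [hwe]; simp only [mul_assoc]
    rw [h3] at h2
    have h4 : 0 ≤ e' * e' := by
      nth_rewrite 1 [← he's]; exact star_mul_self_nonneg e'
    calc _ ≤ ‖a‖ • (e' * e') := h1
      _ ≤ (1 : ℝ) • (e' * e') := by gcongr
      _ = e' * e' := one_smul _ _
      _ ≤ ‖e'‖ • e' := h2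
      _ ≤ (1 : ℝ) • e' := by gcongr
      _ = e' := one_smul _ _
  have ha'n : ‖e' * a * e'‖ ≤ 1 :=
    (CStarAlgebra.norm_le_norm_of_nonneg_of_le ha'0 ha'1).trans he'1
  have hy'n : ‖T.ψ (e' * a * e')‖ ≤ 1 := (T.ψ_contractive _).trans ha'n
  have h6 := norm_sub_compression_le hq hu hu1 (map_nonneg T.ψ ha'0)
    (OrderHomClass.mono T.ψ ha'1) hy'n hq2 hδ0.le
  set y := T.ψ (e' * a * e') with hy
  have h7 : ‖T.φ (y - q * y * q)‖ ≤ 2 * δ := (T.φ_contractive _).trans h6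
  rw [map_sub] at h7
  have h8 : ‖T.φ y - e' * a * e'‖ < η := hT _ (by simp only [mem_insert, mem_image]; exact Or.inr (Or.inr ⟨a, ha, rfl⟩))
  have h9 : ‖T.φ (q * y * q) - b‖ ≤ ε / 8 := by
    have : μ * (‖y‖ * ‖y‖) ≤ (ε / 8) ^ 2 * (1 * 1) := by rw [hμ]; gcongr
    have h0 := norm_nonneg (T.φ (q * y * q) - b)
    nlinarith
  have h10 : ‖a - e' * a * e'‖ ≤ 2 * η := by
    have e1 : a - e' * a * e' = -(a * e' - a) - (e' * a - a) * e' := by noncomm_ring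
    rw [e1]
    have h1 := he' a ha
    have h2 : ‖(e' * a - a) * e'‖ ≤ η * 1 := (norm_mul_le _ _).trans (by gcongr; exact h1.1.le)
    refine (norm_sub_le _ _).trans ?_
    rw [norm_neg]
    linarith [h1.2]
  have e2 : a - b = (a - e' * a * e') - (T.φ y - e' * a * e') + (T.φ y - T.φ (q * y * q)) +
      (T.φ (q * y * q) - b) := by abel
  rw [e2]
  have t1 := norm_add_le ((a - e' * a * e') - (T.φ y - e' * a * e') + (T.φ y - T.φ (q * y * q)))
    (T.φ (q * y * q) - b)
  have t2 := norm_add_le ((a - e' * a * e') - (T.φ y - e' * a * e')) (T.φ y - T.φ (q * y * q))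
  have t3 := norm_sub_le (a - e' * a * e') (T.φ y - e' * a * e')
  linarith

/-- A C*-algebra of completely positive rank at most zero is locally finite-dimensional. -/
theorem CPRankLE.isLocallyAF (h : CPRankLE A 0) : IsLocallyAF A := by
  classical
  have hpos (s : Finset A) (hs : ∀ a ∈ s, 0 ≤ a) (ε : ℝ) (hε : 0 < ε) :
      ∃ B : NonUnitalStarSubalgebra ℂ A, FiniteDimensional ℂ B ∧
        ∀ a ∈ s, ∃ b ∈ B, ‖a - b‖ < ε := by
    set M : ℝ := 1 + ∑ a ∈ s, ‖a‖ with hM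
    have hM0 : 0 < M := by positivity
    obtain ⟨B, hB, hB'⟩ := h.exists_finiteDimensional_of_nonneg (s.image fun a => M⁻¹ • a) (by
      simp only [mem_image]
      rintro _ ⟨a, ha, rfl⟩
      refine ⟨smul_nonneg (by positivity) (hs a ha), ?_⟩
      rw [norm_smul, Real.norm_of_nonneg (by positivity), inv_mul_le_iff₀ hM0, mul_one]
      have := Finset.single_le_sum (f := fun a : A => ‖a‖) (fun a _ => norm_nonneg a) ha
      linarith) (ε := min 1 (M⁻¹ * ε)) (by positivity) (min_le_left _ _)
    refine ⟨B, hB, fun a ha => ?_⟩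
    obtain ⟨b, hb, hab⟩ := hB' _ (mem_image_of_mem _ ha)
    refine ⟨(M : ℂ) • b, B.smul_mem _ hb, ?_⟩
    have e : a - (M : ℂ) • b = M • (M⁻¹ • a - b) := by
      rw [smul_sub, smul_smul, mul_inv_cancel₀ hM0.ne', one_smul, Complex.coe_smul]
    rw [e, norm_smul, Real.norm_of_nonneg hM0.le]
    calc M * ‖M⁻¹ • a - b‖ < M * (M⁻¹ * ε) := by
          gcongr; exact hab.trans_le (min_le_right _ _)
      _ = ε := by field_simp
  intro s ε hε
  let f : A → Finset A := fun a => {((realPart a : A))⁺, ((realPart a : A))⁻,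
    ((imaginaryPart a : A))⁺, ((imaginaryPart a : A))⁻}
  obtain ⟨B, hB, hB'⟩ := hpos (s.biUnion f) (by
    simp only [mem_biUnion, f, mem_insert, mem_singleton]
    rintro _ ⟨a, -, rfl | rfl | rfl | rfl⟩
    exacts [CFC.posPart_nonneg _, CFC.negPart_nonneg _, CFC.posPart_nonneg _, CFC.negPart_nonneg _])
    (ε / 4) (by positivity)
  refine ⟨B, hB, fun a ha => ?_⟩
  have hm (c : A) (hc : c ∈ f a) : ∃ b ∈ B, ‖c - b‖ < ε / 4 := hB' c (mem_biUnion.2 ⟨a, ha, hc⟩)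
  obtain ⟨b1, hb1, h1⟩ := hm ((realPart a : A))⁺ (by simp [f])
  obtain ⟨b2, hb2, h2⟩ := hm ((realPart a : A))⁻ (by simp [f])
  obtain ⟨b3, hb3, h3⟩ := hm ((imaginaryPart a : A))⁺ (by simp [f])
  obtain ⟨b4, hb4, h4⟩ := hm ((imaginaryPart a : A))⁻ (by simp [f])
  refine ⟨b1 - b2 + Complex.I • b3 - Complex.I • b4, sub_mem (add_mem (sub_mem hb1 hb2)
    (B.smul_mem _ hb3)) (B.smul_mem _ hb4), ?_⟩
  have e : a - (b1 - b2 + Complex.I • b3 - Complex.I • b4) =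
      ((realPart a : A)⁺ - b1) - ((realPart a : A)⁻ - b2) +
        Complex.I • ((imaginaryPart a : A)⁺ - b3) - Complex.I • ((imaginaryPart a : A)⁻ - b4) := by
    conv_lhs => rw [← CStarAlgebra.linear_combination_nonneg a]
    module
  rw [e]
  have hI (x : A) : ‖Complex.I • x‖ = ‖x‖ := by rw [norm_smul, Complex.norm_I, one_mul]
  have t1 := norm_sub_le (((realPart a : A)⁺ - b1) - ((realPart a : A)⁻ - b2) +
        Complex.I • ((imaginaryPart a : A)⁺ - b3)) (Complex.I • ((imaginaryPart a : A)⁻ - b4))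
  have t2 := norm_add_le (((realPart a : A)⁺ - b1) - ((realPart a : A)⁻ - b2))
    (Complex.I • ((imaginaryPart a : A)⁺ - b3))
  have t3 := norm_sub_le ((realPart a : A)⁺ - b1) ((realPart a : A)⁻ - b2)
  rw [hI] at t1 t2
  linarith

end LocallyFiniteDimensional

/-! ### Newton's method for almost multiplicative maps. -/

section Newton

variable {F A : Type*} [CStarAlgebra F] [CStarAlgebra A] {n : ℕ}
  {f : Fin n → F}

/-- The failure of a linear map to be multiplicative. -/
noncomputable def mulDefect (T : F →ₗ[ℂ] A) (x y : F) : A := T (x * y) - T x * T y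

/-- The correction term in Newton's method for making a linear map multiplicative. -/
noncomputable def newtonCorrection (f : Fin n → F) (T : F →ₗ[ℂ] A) : F →ₗ[ℂ] A :=
  ∑ i, (LinearMap.mulLeft ℂ (T (f i)) ∘ₗ
    (T ∘ₗ LinearMap.mulLeft ℂ (star (f i)) - LinearMap.mulLeft ℂ (T (star (f i))) ∘ₗ T))

theorem newtonCorrection_apply (T : F →ₗ[ℂ] A) (x : F) :
    newtonCorrection f T x = ∑ i, T (f i) * mulDefect T (star (f i)) x := by
  simp [newtonCorrection, mulDefect]

variable [FiniteDimensional ℂ F]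

/-- The defect `D` satisfies the twisted cocycle identity `T a D(b,c) - D(ab,c) + D(a,bc) - D(a,b) T
c = 0`. Averaging it against the Casimir element exhibits `D` as a coboundary up to higher order, as
for vanishing Hochschild cohomology. The correction removes the linear part, and every remaining
term is quadratic in `D`. -/
theorem mulDefect_add_newtonCorrection (hf : IsTraceFrame f) {T : F →ₗ[ℂ] A} (hT : T 1 = 1)
    (x y : F) :
    mulDefect (T + newtonCorrection f T) x y =
      (∑ i, mulDefect T (f i) (star (f i))) * mulDefect T x y +
        ∑ i, mulDefect T x (f i) * mulDefect T (star (f i)) y -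
        newtonCorrection f T x * newtonCorrection f T y := by
  have hcas := hf.casimir (LinearMap.mk₂ ℂ (fun a b => T a * mulDefect T b y)
    (by intros; simp [add_mul]) (by intros; simp)
    (by intros; simp only [mulDefect, add_mul, map_add, mul_add, mul_sub]; abel)
    (by intros; simp only [mulDefect, smul_mul_assoc, map_smul, mul_smul_comm, mul_sub, smul_sub])) x
  simp only [LinearMap.mk₂_apply] at hcas
  have h1 (i) : T (x * f i) * mulDefect T (star (f i)) y =
      T x * (T (f i) * mulDefect T (star (f i)) y) +
        mulDefect T x (f i) * mulDefect T (star (f i)) y := by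
    rw [← mul_assoc, ← add_mul]; congr 1; simp [mulDefect]
  have h2 (i) : T (f i) * mulDefect T (star (f i) * x) y =
      T (f i) * T (star (f i)) * mulDefect T x y + T (f i) * mulDefect T (star (f i)) (x * y) -
        T (f i) * mulDefect T (star (f i)) x * T y := by
    simp only [mulDefect, mul_assoc, mul_sub, sub_mul]; abel
  have h3 : ∑ i, T (f i) * T (star (f i)) = 1 - ∑ i, mulDefect T (f i) (star (f i)) := by
    simp only [mulDefect, Finset.sum_sub_distrib]
    rw [← map_sum, hf.sum_mul_star (u := 1) (fun x => mul_one x), hT]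
    abel
  simp only [h1, h2, Finset.sum_add_distrib, Finset.sum_sub_distrib, ← Finset.mul_sum,
    ← Finset.sum_mul, h3, ← newtonCorrection_apply] at hcas
  have h4 : T x * newtonCorrection f T y =
      (1 - ∑ i, mulDefect T (f i) (star (f i))) * mulDefect T x y + newtonCorrection f T (x * y) -
        newtonCorrection f T x * T y - ∑ i, mulDefect T x (f i) * mulDefect T (star (f i)) y :=
    eq_sub_of_add_eq hcas
  have h5 : mulDefect (T + newtonCorrection f T) x y = mulDefect T x y +
      newtonCorrection f T (x * y) - T x * newtonCorrection f T y - newtonCorrection f T x * T y -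
        newtonCorrection f T x * newtonCorrection f T y := by
    simp only [mulDefect, LinearMap.add_apply, add_mul, mul_add]; abel
  rw [h5, h4, sub_mul, one_mul]
  abel

/-- The invariant of Newton's method. -/
structure IsNewtonIterate (B : Subalgebra ℂ A) (K ε : ℝ) (T : F →ₗ[ℂ] A) : Prop where
  map_one : T 1 = 1
  mem : ∀ x, T x ∈ B
  -- Halving `ε` raises this bound by `2Kε`, exactly the size of one correction, so the norms stay
  -- below `2` throughout.
  bound : ∀ x, ‖T x‖ ≤ (2 - 4 * K * ε) * ‖x‖
  defect : ∀ x y, ‖mulDefect T x y‖ ≤ ε * (‖x‖ * ‖y‖)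

theorem IsNewtonIterate.step {B : Subalgebra ℂ A} {K ε : ℝ} {T : F →ₗ[ℂ] A}
    (hT : IsNewtonIterate B K ε T) (hf : IsTraceFrame f) (hK1 : 1 ≤ K)
    (hK : ∑ i, ‖f i‖ * ‖f i‖ ≤ K) (hε : 0 ≤ ε) (hε1 : 12 * K ^ 2 * ε ≤ 1) :
    IsNewtonIterate B K (ε / 2) (T + newtonCorrection f T) ∧
      ∀ x, ‖(T + newtonCorrection f T) x - T x‖ ≤ 2 * K * ε * ‖x‖ := by
  have hK0 : 0 ≤ K := by linarith
  have hKε : 0 ≤ 4 * K * ε := by positivity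
  have hb2 (x) : ‖T x‖ ≤ 2 * ‖x‖ :=
    (hT.bound x).trans (by gcongr; linarith)
  have hc (x) : ‖newtonCorrection f T x‖ ≤ 2 * K * ε * ‖x‖ := by
    rw [newtonCorrection_apply]
    calc _ ≤ ∑ i, ‖T (f i) * mulDefect T (star (f i)) x‖ := norm_sum_le _ _
      _ ≤ ∑ i, 2 * ε * ‖x‖ * (‖f i‖ * ‖f i‖) := by
        refine Finset.sum_le_sum fun i _ => (norm_mul_le _ _).trans ?_
        have := hT.defect (star (f i)) x
        rw [norm_star] at this
        calc _ ≤ 2 * ‖f i‖ * (ε * (‖f i‖ * ‖x‖)) := by gcongr; exact hb2 _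
          _ = _ := by ring
      _ = 2 * ε * ‖x‖ * ∑ i, ‖f i‖ * ‖f i‖ := by rw [Finset.mul_sum]
      _ ≤ 2 * ε * ‖x‖ * K := by gcongr
      _ = _ := by ring
  refine ⟨⟨?_, fun x => ?_, fun x => ?_, fun x y => ?_⟩, fun x => ?_⟩
  · rw [LinearMap.add_apply, newtonCorrection_apply, hT.map_one]
    simp [mulDefect, hT.map_one]
  · rw [LinearMap.add_apply, newtonCorrection_apply]
    exact add_mem (hT.mem x) (sum_mem fun i _ => mul_mem (hT.mem _)
      (sub_mem (hT.mem _) (mul_mem (hT.mem _) (hT.mem _))))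
  · rw [LinearMap.add_apply]
    calc _ ≤ (2 - 4 * K * ε) * ‖x‖ + 2 * K * ε * ‖x‖ :=
          (norm_add_le _ _).trans (add_le_add (hT.bound x) (hc x))
      _ = _ := by ring
  · rw [mulDefect_add_newtonCorrection hf hT.map_one]
    have t1 : ‖(∑ i, mulDefect T (f i) (star (f i))) * mulDefect T x y‖ ≤
        K * ε ^ 2 * (‖x‖ * ‖y‖) := by
      have : ‖∑ i, mulDefect T (f i) (star (f i))‖ ≤ ε * K := by
        calc _ ≤ ∑ i, ‖mulDefect T (f i) (star (f i))‖ := norm_sum_le _ _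
          _ ≤ ∑ i, ε * (‖f i‖ * ‖f i‖) := by
            refine Finset.sum_le_sum fun i _ => (hT.defect _ _).trans ?_
            rw [norm_star]
          _ ≤ ε * K := by rw [← Finset.mul_sum]; gcongr
      calc _ ≤ ε * K * (ε * (‖x‖ * ‖y‖)) :=
            (norm_mul_le _ _).trans (by gcongr; exact hT.defect _ _)
        _ = _ := by ring
    have t2 : ‖∑ i, mulDefect T x (f i) * mulDefect T (star (f i)) y‖ ≤
        K * ε ^ 2 * (‖x‖ * ‖y‖) := by
      calc _ ≤ ∑ i, ‖mulDefect T x (f i) * mulDefect T (star (f i)) y‖ := norm_sum_le _ _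
        _ ≤ ∑ i, ε ^ 2 * (‖x‖ * ‖y‖) * (‖f i‖ * ‖f i‖) := by
          refine Finset.sum_le_sum fun i _ => (norm_mul_le _ _).trans ?_
          have := hT.defect (star (f i)) y
          rw [norm_star] at this
          calc _ ≤ (ε * (‖x‖ * ‖f i‖)) * (ε * (‖f i‖ * ‖y‖)) := by gcongr; exact hT.defect _ _
            _ = _ := by ring
        _ ≤ ε ^ 2 * (‖x‖ * ‖y‖) * K := by rw [← Finset.mul_sum]; gcongr
        _ = _ := by ring
    have t3 : ‖newtonCorrection f T x * newtonCorrection f T y‖ ≤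
        4 * K ^ 2 * ε ^ 2 * (‖x‖ * ‖y‖) := by
      calc _ ≤ (2 * K * ε * ‖x‖) * (2 * K * ε * ‖y‖) :=
            (norm_mul_le _ _).trans (by gcongr <;> exact hc _)
        _ = _ := by ring
    -- As `K ≥ 1`, the left side is at most `6 K² ε²`, whence the hypothesis `12 K² ε ≤ 1`. Halving
    -- the defect is all that is needed for convergence.
    have h6 : 2 * (K * ε ^ 2) + 4 * K ^ 2 * ε ^ 2 ≤ ε / 2 := by
      have : K ≤ K ^ 2 := by nlinarith
      have h7 : K * ε ^ 2 ≤ K ^ 2 * ε ^ 2 := by gcongr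
      have h8 : 12 * K ^ 2 * ε * ε ≤ 1 * ε := by gcongr
      nlinarith
    have h9 := mul_le_mul_of_nonneg_right h6 (mul_nonneg (norm_nonneg x) (norm_nonneg y))
    refine (norm_sub_le _ _).trans ?_
    have := norm_add_le ((∑ i, mulDefect T (f i) (star (f i))) * mulDefect T x y)
      (∑ i, mulDefect T x (f i) * mulDefect T (star (f i)) y)
    linarith
  · rw [LinearMap.add_apply, add_sub_cancel_left]
    exact hc x

/-- Newton's method: an almost multiplicative linear map is close to a multiplicative one. -/
theorem IsNewtonIterate.exists_multiplicative {B : Subalgebra ℂ A} (hB : IsClosed (B : Set A))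
    {K ε : ℝ} {T : F →ₗ[ℂ] A}
    (hT : IsNewtonIterate B K ε T) (hf : IsTraceFrame f) (hK1 : 1 ≤ K)
    (hK : ∑ i, ‖f i‖ * ‖f i‖ ≤ K) (hε : 0 ≤ ε) (hε1 : 12 * K ^ 2 * ε ≤ 1) :
    ∃ σ : F →ₗ[ℂ] A, (∀ x, σ x ∈ B) ∧ (∀ x y, σ (x * y) = σ x * σ y) ∧
      ∀ x, ‖σ x - T x‖ ≤ 4 * K * ε * ‖x‖ := by
  let S : ℕ → F →ₗ[ℂ] A := fun k => (fun T => T + newtonCorrection f T)^[k] T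
  have hε2 (k : ℕ) : ε / 2 ^ k ≤ ε := div_le_self hε (one_le_pow₀ one_le_two)
  have hε3 (k : ℕ) : 12 * K ^ 2 * (ε / 2 ^ k) ≤ 1 := le_trans (by gcongr; exact hε2 k) hε1
  have hS (k : ℕ) : IsNewtonIterate B K (ε / 2 ^ k) (S k) := by
    induction k with
    | zero => simpa [S] using hT
    | succ k ih =>
      have := (ih.step hf hK1 hK (by positivity) (hε3 k)).1
      rw [div_div, ← pow_succ] at this
      simpa only [S, Function.iterate_succ_apply'] using this
  -- The steps `2Kε / 2 ^ k` add up to `4Kε`.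
  have hd (x : F) (k : ℕ) : dist (S k x) (S (k + 1) x) ≤ (4 * K * ε * ‖x‖) / 2 / 2 ^ k := by
    have := ((hS k).step hf hK1 hK (by positivity) (hε3 k)).2 x
    rw [dist_comm, dist_eq_norm]
    simp only [S, Function.iterate_succ_apply'] at this ⊢
    refine this.trans (le_of_eq ?_)
    ring
  have hlim (x : F) : ∃ a, Tendsto (fun k => S k x) atTop (𝓝 a) :=
    cauchySeq_tendsto_of_complete (cauchySeq_of_le_geometric_two (hd x))
  choose g hg using hlim
  let σ : F →ₗ[ℂ] A := linearMapOfTendsto g S (tendsto_pi_nhds.2 hg)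
  have hσ (x) : σ x = g x := rfl
  refine ⟨σ, fun x => ?_, fun x y => ?_, fun x => ?_⟩
  · exact hB.mem_of_tendsto (hg x) (Eventually.of_forall fun k => (hS k).mem x)
  · have h1 : Tendsto (fun k => mulDefect (S k) x y) atTop (𝓝 (σ (x * y) - σ x * σ y)) :=
      (hg (x * y)).sub ((hg x).mul (hg y))
    have h2 : Tendsto (fun k => mulDefect (S k) x y) atTop (𝓝 0) := by
      refine squeeze_zero_norm (fun k => (hS k).defect x y) ?_
      have : Tendsto (fun k : ℕ => ε * (1 / 2 : ℝ) ^ k * (‖x‖ * ‖y‖)) atTop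
          (𝓝 (ε * 0 * (‖x‖ * ‖y‖))) :=
        ((tendsto_pow_atTop_nhds_zero_of_lt_one (by norm_num) (by norm_num)).const_mul ε).mul_const _
      simpa [div_eq_mul_inv] using this
    exact sub_eq_zero.1 (tendsto_nhds_unique h1 h2)
  · have := dist_le_of_le_geometric_two_of_tendsto₀ (hd x) (hg x)
    rw [dist_comm, dist_eq_norm] at this
    exact this

end Newton

/-! ### Conjugating a finite-dimensional algebra into a subalgebra that almost contains it. -/

section Unitary

/-- Square roots of elements close to `1`. -/
theorem exists_sqrt_of_norm_sub_one_le {A : Type*} [CStarAlgebra A] {a : A} (ha : IsSelfAdjoint a)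
    (h : ‖a - 1‖ ≤ 1 / 2) :
    ∃ r r' : A, star r = r ∧ star r' = r' ∧ r * r = a ∧ r * r' = 1 ∧ r' * r = 1 ∧
      ‖r - 1‖ ≤ ‖a - 1‖ ∧ ‖r' - 1‖ ≤ ‖a - 1‖ ∧ (∀ y, Commute a y → Commute r' y) ∧
      ∀ B : StarSubalgebra ℂ A, IsClosed (B : Set A) → a ∈ B → r ∈ B ∧ r' ∈ B := by
  have hid : cfc (fun t : ℝ => t) a = a := cfc_id' ℝ a
  have hspec : ∀ t ∈ spectrum ℝ a, |t - 1| ≤ ‖a - 1‖ ∧ 1 / 2 ≤ t := by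
    intro t ht
    have h1 := norm_apply_le_norm_cfc (fun t : ℝ => t - 1) a ht
    rw [cfc_sub (fun t : ℝ => t) (fun _ => 1) a, hid, cfc_const_one ℝ a] at h1
    refine ⟨h1, ?_⟩
    have := (abs_le.1 (h1.trans h)).1
    linarith
  have hc1 : ContinuousOn Real.sqrt (spectrum ℝ a) := Real.continuous_sqrt.continuousOn
  have hc2 : ContinuousOn (fun t => (Real.sqrt t)⁻¹) (spectrum ℝ a) :=
    hc1.inv₀ fun t ht => (Real.sqrt_pos.2 (by linarith [(hspec t ht).2])).ne'
  have hrr' : cfc Real.sqrt a * cfc (fun t => (Real.sqrt t)⁻¹) a = 1 := by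
    rw [← cfc_mul _ _ a hc1 hc2, ← cfc_const_one ℝ a]
    refine cfc_congr fun t ht => ?_
    exact mul_inv_cancel₀ (Real.sqrt_pos.2 (by linarith [(hspec t ht).2])).ne'
  refine ⟨cfc Real.sqrt a, cfc (fun t => (Real.sqrt t)⁻¹) a,
    (cfc_predicate Real.sqrt a : IsSelfAdjoint _).star_eq,
    (cfc_predicate (fun t => (Real.sqrt t)⁻¹) a : IsSelfAdjoint _).star_eq, ?_, hrr', ?_, ?_, ?_,
    fun y hy => hy.cfc_real _, fun B hB haB => ?_⟩
  · rw [← cfc_mul _ _ a hc1 hc1]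
    conv_rhs => rw [← hid]
    exact cfc_congr fun t ht => Real.mul_self_sqrt (by linarith [(hspec t ht).2])
  · rw [← hrr']; exact cfc_commute_cfc _ _ _
  · have e : cfc Real.sqrt a - 1 = cfc (fun t => Real.sqrt t - 1) a := by
      rw [cfc_sub Real.sqrt (fun _ => 1) a hc1 continuousOn_const, cfc_const_one ℝ a]
    rw [e]
    refine norm_cfc_le (norm_nonneg _) fun t ht => ?_
    obtain ⟨h1, h2⟩ := hspec t ht
    have h3 := Real.mul_self_sqrt (show 0 ≤ t by linarith)
    have h4 := Real.sqrt_nonneg t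
    refine le_trans ?_ h1
    have e2 : t - 1 = (Real.sqrt t - 1) * (Real.sqrt t + 1) := by linarith
    rw [e2, abs_mul, Real.norm_eq_abs]
    refine le_mul_of_one_le_right (abs_nonneg _) ?_
    rw [abs_of_nonneg (by linarith)]; linarith
  · have e : cfc (fun t => (Real.sqrt t)⁻¹) a - 1 = cfc (fun t => (Real.sqrt t)⁻¹ - 1) a := by
      rw [cfc_sub (fun t => (Real.sqrt t)⁻¹) (fun _ => 1) a hc2 continuousOn_const, cfc_const_one ℝ a]
    rw [e]
    refine norm_cfc_le (norm_nonneg _) fun t ht => ?_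
    obtain ⟨h1, h2⟩ := hspec t ht
    have h3 := Real.mul_self_sqrt (show 0 ≤ t by linarith)
    have h4 := Real.sqrt_pos.2 (show 0 < t by linarith)
    refine le_trans ?_ h1
    -- The factor `(√t + 1) √t = t + √t` is at least `1` because `t ≥ 1/2`.
    have e2 : t - 1 = -(((Real.sqrt t)⁻¹ - 1) * ((Real.sqrt t + 1) * Real.sqrt t)) := by
      have h5 : (Real.sqrt t)⁻¹ * Real.sqrt t = 1 := inv_mul_cancel₀ h4.ne'
      linear_combination (-1 : ℝ) * h3 + (Real.sqrt t + 1) * h5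
    rw [e2, abs_neg, abs_mul, Real.norm_eq_abs]
    refine le_mul_of_one_le_right (abs_nonneg _) ?_
    rw [abs_of_nonneg (by positivity)]
    have : 1 / 2 ≤ Real.sqrt t := by
      rw [Real.le_sqrt (by norm_num) (by linarith)]; linarith
    nlinarith
  · exact ⟨cfc_mem (hs := hB) _ haB, cfc_mem (hs := hB) _ haB⟩

/-- The unitary in the polar decomposition of an element close to `1` that intertwines two
self-adjoint families. -/
theorem exists_unitary_intertwiner {A : Type*} [CStarAlgebra A] {F : Type*} [Star F] {ι σ : F → A}
    (hι : ∀ x, ι (star x) = star (ι x)) (hσ : ∀ x, σ (star x) = star (σ x)) {s : A}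
    (hs : ∀ x, s * ι x = σ x * s) {θ : ℝ} (hθ : ‖s - 1‖ ≤ θ) (hθ1 : θ ≤ 1 / 6) :
    ∃ w ∈ unitary A, ‖w - 1‖ ≤ 7 * θ ∧ ∀ x, w * ι x * star w = σ x := by
  by_cases hA : Nontrivial A
  swap
  · rw [not_nontrivial_iff_subsingleton] at hA
    refine ⟨1, one_mem _, ?_, fun x => Subsingleton.elim _ _⟩
    rw [sub_self, norm_zero]
    have := (norm_nonneg _).trans hθ
    linarith
  have hθ0 : 0 ≤ θ := (norm_nonneg _).trans hθ
  have hs2 : ‖s‖ ≤ 1 + θ := by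
    have := norm_add_le (s - 1) 1
    rw [sub_add_cancel, norm_one] at this
    linarith
  have hss : ‖star s * s - 1‖ ≤ 3 * θ := by
    have e : star s * s - 1 = star s * (s - 1) + star (s - 1) := by
      rw [star_sub, star_one]; noncomm_ring
    rw [e]
    have h1 : ‖star s * (s - 1)‖ ≤ (1 + θ) * θ := by
      refine (norm_mul_le _ _).trans ?_
      rw [norm_star]
      gcongr
    have h2 : ‖star (s - 1)‖ ≤ θ := by rwa [norm_star]
    refine (norm_add_le _ _).trans ?_
    nlinarith
  obtain ⟨r, r', -, hr's, hrr, hrr', hr'r, -, hr'1, hcomm, -⟩ :=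
    exists_sqrt_of_norm_sub_one_le (IsSelfAdjoint.star_mul_self s) (hss.trans (by linarith))
  -- Both families are self-adjoint, so `star s` intertwines backwards. Hence `|s|⁻¹ = r'` commutes
  -- with `ι x`, and `w = s |s|⁻¹` still intertwines.
  have hc (x : F) : Commute (star s * s) (ι x) := by
    have h1 : ι x * star s = star s * σ x := by
      have := congrArg star (hs (star x))
      rwa [star_mul, star_mul, hι, hσ, star_star, star_star] at this
    calc star s * s * ι x = star s * σ x * s := by rw [mul_assoc, hs, ← mul_assoc]
      _ = ι x * (star s * s) := by rw [← h1, mul_assoc]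
  -- Invertibility of `s` makes the isometry `s * r'` a unitary.
  obtain ⟨v, hv⟩ : IsUnit s := by
    have : ‖1 - s‖ < 1 := by rw [norm_sub_rev]; linarith
    exact ⟨Units.oneSub (1 - s) this, by simp⟩
  have hw1 : star (s * r') * (s * r') = 1 := by
    calc star (s * r') * (s * r') = r' * (star s * s) * r' := by
          rw [star_mul, hr's]; simp only [mul_assoc]
      _ = (r' * r) * (r * r') := by rw [← hrr]; simp only [mul_assoc]
      _ = 1 := by rw [hrr', hr'r, one_mul]
  have hw2 : (s * r') * star (s * r') = 1 := by
    have h1 : (s * r') * (r * ↑v⁻¹) = 1 := by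
      rw [mul_assoc, ← mul_assoc r', hr'r, one_mul, ← hv, Units.mul_inv]
    have h2 : star (s * r') = r * ↑v⁻¹ := left_inv_eq_right_inv hw1 h1
    rw [h2, h1]
  refine ⟨s * r', ⟨hw1, hw2⟩, ?_, fun x => ?_⟩
  · have e : s * r' - 1 = s * (r' - 1) + (s - 1) := by noncomm_ring
    rw [e]
    have h1 : ‖s * (r' - 1)‖ ≤ (1 + θ) * (3 * θ) := by
      refine (norm_mul_le _ _).trans ?_
      gcongr
      exact hr'1.trans hss
    refine (norm_add_le _ _).trans ?_
    nlinarith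
  · rw [mul_assoc s, (hcomm _ (hc x)).eq, ← mul_assoc, hs, mul_assoc (σ x), mul_assoc (σ x), hw2, mul_one]

variable {F A : Type*} [CStarAlgebra F] [FiniteDimensional ℂ F] [CStarAlgebra A] {n : ℕ}
  {f : Fin n → F}

/-- If a multiplicative linear map `σ` with values in `B` is close to a *-homomorphism `ι` then
the range of `ι` can be conjugated into `B` by a unitary close to `1`. -/
theorem exists_unitary_of_multiplicative (hf : IsTraceFrame f) {B : StarSubalgebra ℂ A}
    (hB : IsClosed (B : Set A)) (ι : F →⋆ₐ[ℂ] A) (σ : F →ₗ[ℂ] A) (hσB : ∀ x, σ x ∈ B)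
    (hσ : ∀ x y, σ (x * y) = σ x * σ y) {K θ : ℝ} (hK1 : 1 ≤ K) (hK : ∑ i, ‖f i‖ * ‖f i‖ ≤ K)
    (hθ0 : 0 ≤ θ) (hθ1 : 30 * K * θ ≤ 1) (hθ : ∀ x, ‖σ x - ι x‖ ≤ θ * ‖x‖) :
    ∃ w ∈ unitary A, ‖w - 1‖ ≤ 35 * K * θ ∧ ∀ x, w * ι x * star w ∈ B := by
  have hKθ : 0 ≤ K * θ := by positivity
  have hθ2 : θ ≤ 1 := by nlinarith
  have hιn (x : F) : ‖ι x‖ ≤ ‖x‖ := NonUnitalStarAlgHom.norm_apply_le ι x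
  have hσn (x : F) : ‖σ x‖ ≤ 2 * ‖x‖ := by
    have := norm_add_le (σ x - ι x) (ι x)
    rw [sub_add_cancel] at this
    have h1 := hθ x
    have h2 := hιn x
    nlinarith [norm_nonneg x]
  have hsum : ∑ i, ι (f i) * ι (star (f i)) = 1 := by
    simp only [← map_mul]
    rw [← map_sum, hf.sum_mul_star (u := 1) (fun x => mul_one x), map_one]
  -- By the Casimir property `(σ x)* h = h σ (x*)`, so `σ` is *-preserving for the form twisted by
  -- `h`. Since `h` is in `B` and close to `1`, conjugating `σ` by `r = √h` gives a *-homomorphism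
  -- into `B`.
  set h : A := ∑ i, star (σ (star (f i))) * σ (star (f i)) with hh
  have hh1 : ‖h - 1‖ ≤ 3 * (K * θ) := by
    rw [hh, ← hsum, ← Finset.sum_sub_distrib]
    calc _ ≤ ∑ i, ‖star (σ (star (f i))) * σ (star (f i)) - ι (f i) * ι (star (f i))‖ :=
          norm_sum_le _ _
      _ ≤ ∑ i, 3 * θ * (‖f i‖ * ‖f i‖) := by
        refine Finset.sum_le_sum fun i _ => ?_
        have e : star (σ (star (f i))) * σ (star (f i)) - ι (f i) * ι (star (f i)) =
            star (σ (star (f i)) - ι (star (f i))) * σ (star (f i)) +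
              ι (f i) * (σ (star (f i)) - ι (star (f i))) := by
          rw [star_sub, ← map_star ι, star_star]; noncomm_ring
        rw [e]
        have h0 := hθ (star (f i))
        have h0' := hσn (star (f i))
        rw [norm_star] at h0 h0'
        have h1 : ‖star (σ (star (f i)) - ι (star (f i))) * σ (star (f i))‖ ≤
            (θ * ‖f i‖) * (2 * ‖f i‖) := by
          refine (norm_mul_le _ _).trans ?_
          rw [norm_star]
          gcongr
        have h2 : ‖ι (f i) * (σ (star (f i)) - ι (star (f i)))‖ ≤ ‖f i‖ * (θ * ‖f i‖) := by
          refine (norm_mul_le _ _).trans ?_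
          gcongr
          exact hιn _
        refine (norm_add_le _ _).trans ?_
        linarith
      _ ≤ 3 * (K * θ) := by
        rw [← Finset.mul_sum]
        calc _ ≤ 3 * θ * K := by gcongr
          _ = _ := by ring
  have hhs : IsSelfAdjoint h := by
    rw [IsSelfAdjoint, hh, star_sum]
    exact Finset.sum_congr rfl fun i _ => by rw [star_mul, star_star]
  have hhB : h ∈ B := sum_mem fun i _ => mul_mem (star_mem (hσB _)) (hσB _)
  obtain ⟨r, r', hrs, hr's, hrr, hrr', hr'r, hr1, -, -, hmem⟩ :=
    exists_sqrt_of_norm_sub_one_le hhs (hh1.trans (by linarith))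
  obtain ⟨hrB, hr'B⟩ := hmem B hB hhB
  have hint (x : F) : star (σ x) * h = h * σ (star x) := by
    have := hf.casimir (LinearMap.mk₂ ℂ (fun a b => star (σ (star a)) * σ b)
      (by intros; simp [add_mul]) (by intros; simp) (by intros; simp [mul_add]) (by intros; simp))
      (star x)
    simp only [LinearMap.mk₂_apply, star_mul, star_star, hσ] at this
    simp only [hh, Finset.mul_sum, Finset.sum_mul]
    simpa only [mul_assoc] using this
  -- By the Casimir property `s0` intertwines `ι` with `σ`, so `r * s0` intertwines `ι` with `r σ
  -- r'`. Its distance `5Kθ` from `1` must be at most `1/6`, whence `30Kθ ≤ 1`, and `35 = 7 · 5`.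
  set s0 : A := ∑ i, σ (f i) * ι (star (f i)) with hs0
  have hs01 : ‖s0 - 1‖ ≤ K * θ := by
    rw [hs0, ← hsum, ← Finset.sum_sub_distrib]
    calc _ ≤ ∑ i, ‖σ (f i) * ι (star (f i)) - ι (f i) * ι (star (f i))‖ := norm_sum_le _ _
      _ ≤ ∑ i, θ * (‖f i‖ * ‖f i‖) := by
        refine Finset.sum_le_sum fun i _ => ?_
        rw [← sub_mul, ← mul_assoc]
        refine (norm_mul_le _ _).trans ?_
        gcongr
        · exact hθ _
        · exact (hιn _).trans (norm_star _).le
      _ ≤ K * θ := by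
        rw [← Finset.mul_sum, mul_comm]
        gcongr
  have hs0x (x : F) : s0 * ι x = σ x * s0 := by
    have := hf.casimir (LinearMap.mk₂ ℂ (fun a b => σ a * ι b)
      (by intros; simp [add_mul]) (by intros; simp) (by intros; simp [mul_add]) (by intros; simp)) x
    simp only [LinearMap.mk₂_apply, hσ, map_mul] at this
    simp only [hs0, Finset.mul_sum, Finset.sum_mul]
    simp only [mul_assoc] at this ⊢
    exact this.symm
  have hs1 : ‖r * s0 - 1‖ ≤ 5 * (K * θ) := by
    have e : r * s0 - 1 = (r - 1) * (s0 - 1) + (r - 1) + (s0 - 1) := by noncomm_ring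
    rw [e]
    have h1 : ‖(r - 1) * (s0 - 1)‖ ≤ (3 * (K * θ)) * (K * θ) :=
      (norm_mul_le _ _).trans (by gcongr; exact hr1.trans hh1)
    have h2 := hr1.trans hh1
    have := norm_add₃_le (a := (r - 1) * (s0 - 1)) (b := r - 1) (c := s0 - 1)
    nlinarith
  obtain ⟨w, hw, hw1, hwx⟩ := exists_unitary_intertwiner (ι := ι) (σ := fun x => r * σ x * r')
    (s := r * s0) (θ := 5 * (K * θ)) (fun x => map_star ι x) (fun x => by
      rw [star_mul, star_mul, hrs, hr's]
      calc r * σ (star x) * r' = r' * (r * r * σ (star x)) * r' := by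
            rw [← mul_assoc, ← mul_assoc, hr'r, one_mul]
        _ = r' * (star (σ x) * (r * r)) * r' := by rw [hrr, hint]
        _ = r' * (star (σ x) * r) * (r * r') := by simp only [mul_assoc]
        _ = r' * (star (σ x) * r) := by rw [hrr', mul_one]) (fun x => by
      calc r * s0 * ι x = r * σ x * s0 := by rw [mul_assoc, hs0x, ← mul_assoc]
        _ = r * σ x * (r' * r) * s0 := by rw [hr'r, mul_one]
        _ = r * σ x * r' * (r * s0) := by simp only [mul_assoc]) hs1 (by linarith)
  refine ⟨w, hw, hw1.trans (by linarith), fun x => ?_⟩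
  rw [hwx]
  exact mul_mem (mul_mem hrB (hσB x)) hr'B

/-- If finitely many elements of a finite-dimensional algebra are almost contained in `B` then
its inclusion is close to a unital linear map with values in `B`. -/
theorem exists_linear_approximation (F : Type*) [CStarAlgebra F] [FiniteDimensional ℂ F]
    [Nontrivial F] :
    ∃ C > 0, ∃ t : Finset F, ∀ {A : Type u} [CStarAlgebra A] (B : StarSubalgebra ℂ A)
      (ι : F →⋆ₐ[ℂ] A) (δ : ℝ), 0 ≤ δ → (∀ x ∈ t, ∃ b ∈ B, ‖ι x - b‖ ≤ δ) →
      ∃ T : F →ₗ[ℂ] A, T 1 = 1 ∧ (∀ x, T x ∈ B) ∧ ∀ x, ‖T x - ι x‖ ≤ C * δ * ‖x‖ := by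
  classical
  obtain ⟨m, ⟨e⟩⟩ : ∃ m : ℕ, Nonempty (Module.Basis (Fin m) ℂ F) := ⟨_, ⟨Module.finBasis ℂ F⟩⟩
  obtain ⟨C, hC0, hC⟩ : ∃ C : ℝ, 0 < C ∧ ∀ x, ∑ i, ‖e.repr x i‖ ≤ C * ‖x‖ := by
    let c : Fin m → F →L[ℂ] ℂ := fun i => (e.coord i).toContinuousLinearMap
    have h0 : 0 ≤ ∑ i, ‖c i‖ := Finset.sum_nonneg fun i _ => norm_nonneg (c i)
    refine ⟨1 + ∑ i, ‖c i‖, add_pos_of_pos_of_nonneg one_pos h0, fun x => ?_⟩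
    calc ∑ i, ‖e.repr x i‖ ≤ ∑ i, ‖c i‖ * ‖x‖ := Finset.sum_le_sum fun i _ => (c i).le_opNorm x
      _ = (∑ i, ‖c i‖) * ‖x‖ := by rw [Finset.sum_mul]
      _ ≤ _ := mul_le_mul_of_nonneg_right (le_add_of_nonneg_left zero_le_one) (norm_nonneg x)
  -- A norm-one functional with `ℓ 1 = 1` allows a rank-one correction at `1`; the result is unital,
  -- stays in `B`, and the error at most doubles.
  obtain ⟨ℓ, hℓ, hℓ1⟩ := exists_dual_vector ℂ (1 : F) (by simp)
  rw [norm_one, RCLike.ofReal_one] at hℓ1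
  refine ⟨2 * C, by positivity, Finset.univ.image e, ?_⟩
  intro A _ B ι δ hδ hι
  have hb (i) : ∃ b ∈ B, ‖ι (e i) - b‖ ≤ δ := hι _ (by simp)
  choose b hbB hb using hb
  let T0 : F →ₗ[ℂ] A := e.constr ℂ b
  have hT0 (x) : T0 x = ∑ i, e.repr x i • b i := e.constr_apply_fintype ℂ b x
  have hT0d (x) : ‖T0 x - ι x‖ ≤ C * δ * ‖x‖ := by
    have e1 : ι x = ∑ i, e.repr x i • ι (e i) := by
      conv_lhs => rw [← e.sum_repr x, map_sum]
      simp only [map_smul]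
    rw [hT0, e1, ← Finset.sum_sub_distrib]
    calc _ ≤ ∑ i, ‖e.repr x i • b i - e.repr x i • ι (e i)‖ := norm_sum_le _ _
      _ ≤ ∑ i, ‖e.repr x i‖ * δ := by
        refine Finset.sum_le_sum fun i _ => ?_
        rw [← smul_sub, norm_smul, norm_sub_rev]
        exact mul_le_mul_of_nonneg_left (hb i) (norm_nonneg _)
      _ = (∑ i, ‖e.repr x i‖) * δ := by rw [Finset.sum_mul]
      _ ≤ C * ‖x‖ * δ := mul_le_mul_of_nonneg_right (hC x) hδ
      _ = _ := by ring
  let T : F →ₗ[ℂ] A := T0 + (ℓ : F →ₗ[ℂ] ℂ).smulRight (1 - T0 1)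
  have hT (x) : T x = T0 x + ℓ x • (1 - T0 1) := rfl
  refine ⟨T, ?_, fun x => ?_, fun x => ?_⟩
  · rw [hT, hℓ1, one_smul]; abel
  · rw [hT, hT0, hT0]
    have h1 (y) : ∑ i, e.repr y i • b i ∈ B := sum_mem fun i _ => B.smul_mem (hbB i) _
    exact add_mem (h1 x) (B.smul_mem (sub_mem (one_mem B) (h1 1)) _)
  · have e1 : T x - ι x = (T0 x - ι x) + ℓ x • (1 - T0 1) := by rw [hT]; abel
    have h0 : ‖1 - T0 1‖ ≤ C * δ * 1 := by
      have := hT0d 1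
      rwa [map_one ι, norm_one, norm_sub_rev] at this
    have h1 : ‖ℓ x • (1 - T0 1)‖ ≤ (1 * ‖x‖) * (C * δ * 1) := by
      rw [norm_smul]
      refine mul_le_mul ?_ h0 (norm_nonneg _) (by positivity)
      rw [← hℓ]; exact ℓ.le_opNorm x
    rw [e1]
    refine (norm_add_le _ _).trans ?_
    have := hT0d x
    linarith

omit [FiniteDimensional ℂ F] in
theorem isNewtonIterate_of_norm_sub_le {B : Subalgebra ℂ A} {ι : F →⋆ₐ[ℂ] A} {T : F →ₗ[ℂ] A}
    (hT1 : T 1 = 1) (hTB : ∀ x, T x ∈ B) {K τ : ℝ} (hτ0 : 0 ≤ τ) (hτ1 : τ + 16 * (K * τ) ≤ 1)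
    (hK : 1 ≤ K) (hT : ∀ x, ‖T x - ι x‖ ≤ τ * ‖x‖) : IsNewtonIterate B K (4 * τ) T := by
  have hιn (x : F) : ‖ι x‖ ≤ ‖x‖ := NonUnitalStarAlgHom.norm_apply_le ι x
  have hτ2 : τ ≤ 1 := by nlinarith
  have hTn (x) : ‖T x‖ ≤ (1 + τ) * ‖x‖ := by
    have := norm_add_le (T x - ι x) (ι x)
    rw [sub_add_cancel] at this
    have h1 := hT x
    have h2 := hιn x
    linarith
  refine ⟨hT1, hTB, fun x => ?_, fun x y => ?_⟩
  · refine (hTn x).trans ?_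
    gcongr
    linarith
  -- The three terms cost `τ`, `2τ` and `τ`.
  · have e1 : mulDefect T x y = (T (x * y) - ι (x * y)) - (T x - ι x) * T y -
        ι x * (T y - ι y) := by
      rw [mulDefect, map_mul ι]; noncomm_ring
    have h1 := hT (x * y)
    have h2 : ‖(T x - ι x) * T y‖ ≤ (τ * ‖x‖) * ((1 + 1) * ‖y‖) := by
      refine (norm_mul_le _ _).trans (mul_le_mul (hT x) ((hTn y).trans ?_) (norm_nonneg _)
        (by positivity))
      gcongr
    have h3 : ‖ι x * (T y - ι y)‖ ≤ ‖x‖ * (τ * ‖y‖) :=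
      (norm_mul_le _ _).trans (mul_le_mul (hιn x) (hT y) (norm_nonneg _) (norm_nonneg _))
    have h4 : τ * ‖x * y‖ ≤ τ * (‖x‖ * ‖y‖) := by gcongr; exact norm_mul_le _ _
    rw [e1]
    have h5 := norm_sub_le ((T (x * y) - ι (x * y)) - (T x - ι x) * T y) (ι x * (T y - ι y))
    have h6 := norm_sub_le (T (x * y) - ι (x * y)) ((T x - ι x) * T y)
    linarith

/-- Perturbation of finite-dimensional subalgebras: if a finite-dimensional C*-algebra is almost
contained in `B` then it can be conjugated into `B` by a unitary close to `1`. -/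
theorem exists_unitary_conjugation (F : Type*) [CStarAlgebra F] [FiniteDimensional ℂ F]
    [Nontrivial F] {ε : ℝ} (hε : 0 < ε) :
    ∃ δ > 0, ∃ t : Finset F, ∀ {A : Type u} [CStarAlgebra A] (B : StarSubalgebra ℂ A)
      (_ : IsClosed (B : Set A)) (ι : F →⋆ₐ[ℂ] A), (∀ x ∈ t, ∃ b ∈ B, ‖ι x - b‖ ≤ δ) →
      ∃ w ∈ unitary A, ‖w - 1‖ ≤ ε ∧ ∀ x, w * ι x * star w ∈ B := by
  obtain ⟨n, f, hf⟩ := exists_isTraceFrame F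
  obtain ⟨K, hK1, hK⟩ : ∃ K : ℝ, 1 ≤ K ∧ ∑ i, ‖f i‖ * ‖f i‖ ≤ K :=
    ⟨max 1 (∑ i, ‖f i‖ * ‖f i‖), le_max_left _ _, le_max_right _ _⟩
  have hK0 : 0 < K := by linarith
  obtain ⟨C, hC, t, ht⟩ := exists_linear_approximation.{u} F
  -- Newton's method starts with defect `4τ` and ends within `16Kτ + τ ≤ 17Kτ` of `ι`. The constant
  -- `1000` exceeds `12 · 4`, `30 · 17` and `35 · 17`, the multiples of `K² τ` that must be small.
  obtain ⟨τ, hτ⟩ : ∃ τ : ℝ, τ = min 1 ε / (1000 * K ^ 2) := ⟨_, rfl⟩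
  have hτ0 : 0 < τ := by rw [hτ]; positivity
  have hτ2 : 1000 * (K * (K * τ)) = min 1 ε := by rw [hτ]; field_simp
  have hτ3 : 1000 * (K * (K * τ)) ≤ 1 := hτ2.le.trans (min_le_left _ _)
  have hτ4 : 1000 * (K * (K * τ)) ≤ ε := hτ2.le.trans (min_le_right _ _)
  have hτK : τ ≤ K * τ := le_mul_of_one_le_left hτ0.le hK1
  have hKτ : K * τ ≤ K * (K * τ) := le_mul_of_one_le_left (by positivity) hK1
  refine ⟨τ / C, by positivity, t, ?_⟩
  intro A _ B hB ι hι
  obtain ⟨T, hT1, hTB, hTd⟩ := ht B ι (τ / C) (by positivity) hι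
  rw [mul_div_cancel₀ _ hC.ne'] at hTd
  have hN : IsNewtonIterate B.toSubalgebra K (4 * τ) T :=
    isNewtonIterate_of_norm_sub_le hT1 hTB hτ0.le (by linarith) hK1 hTd
  obtain ⟨σ, hσB, hσ, hσT⟩ := hN.exists_multiplicative hB hf hK1 hK (by positivity) (by
    have : 12 * K ^ 2 * (4 * τ) = 48 * (K * (K * τ)) := by ring
    linarith)
  have hσι (x) : ‖σ x - ι x‖ ≤ (17 * (K * τ)) * ‖x‖ := by
    have e1 : σ x - ι x = (σ x - T x) + (T x - ι x) := by abel
    rw [e1]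
    refine (norm_add_le _ _).trans ?_
    have h1 := hσT x
    have h2 := hTd x
    have h3 : τ * ‖x‖ ≤ K * τ * ‖x‖ := by gcongr
    linarith
  obtain ⟨w, hw, hw1, hwB⟩ := exists_unitary_of_multiplicative hf hB ι σ hσB hσ hK1 hK
    (by positivity) (by
      have : 30 * K * (17 * (K * τ)) = 510 * (K * (K * τ)) := by ring
      linarith) hσι
  exact ⟨w, hw, hw1.trans (by
    have : 35 * K * (17 * (K * τ)) = 595 * (K * (K * τ)) := by ring
    linarith), hwB⟩

end Unitary

/-! ### From local approximation to an increasing sequence. -/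

section IncreasingSequence

variable {A : Type u} [NonUnitalCStarAlgebra A]

/-- The unital subalgebra `ℂ + B` of the unitization. -/
def NonUnitalStarSubalgebra.adjoinUnit (B : NonUnitalStarSubalgebra ℂ A) :
    StarSubalgebra ℂ (Unitization ℂ A) where
  carrier := {x | x.snd ∈ B}
  mul_mem' {x y} hx hy := by
    change (x * y).snd ∈ B
    rw [Unitization.snd_mul]
    exact add_mem (add_mem (B.smul_mem _ hy) (B.smul_mem _ hx)) (mul_mem hx hy)
  add_mem' {x y} hx hy := add_mem (S := NonUnitalStarSubalgebra ℂ A) hx hy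
  algebraMap_mem' r := by
    change (algebraMap ℂ (Unitization ℂ A) r).snd ∈ B
    rw [Unitization.algebraMap_eq_inl, Unitization.snd_inl]
    exact zero_mem B
  star_mem' {x} hx := star_mem (S := NonUnitalStarSubalgebra ℂ A) hx

theorem NonUnitalStarSubalgebra.mem_adjoinUnit {B : NonUnitalStarSubalgebra ℂ A}
    {x : Unitization ℂ A} : x ∈ B.adjoinUnit ↔ x.snd ∈ B := Iff.rfl

theorem NonUnitalStarSubalgebra.isClosed_of_finiteDimensional (B : NonUnitalStarSubalgebra ℂ A)
    [h : FiniteDimensional ℂ B] : IsClosed (B : Set A) := by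
  have : FiniteDimensional ℂ B.toNonUnitalSubalgebra.toSubmodule := h
  exact B.toNonUnitalSubalgebra.toSubmodule.closed_of_finiteDimensional

/-- Conjugation by a unitary of the unitization, which need not belong to the algebra. -/
noncomputable def unitizationConj (w : unitary (Unitization ℂ A)) :
    A →⋆ₙₐ[ℂ] Unitization ℂ A :=
  (Unitary.conjStarAlgAut ℂ (Unitization ℂ A) w : Unitization ℂ A →⋆ₙₐ[ℂ] Unitization ℂ A).comp
    (Unitization.inrNonUnitalStarAlgHom ℂ A)

theorem unitizationConj_apply (w : unitary (Unitization ℂ A)) (a : A) :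
    unitizationConj w a = w * (a : Unitization ℂ A) * star (w : Unitization ℂ A) := by
  simp [unitizationConj, Unitary.conjStarAlgAut_apply]

theorem unitizationConj_injective (w : unitary (Unitization ℂ A)) :
    Function.Injective (unitizationConj w) := by
  refine Function.Injective.comp (g := Unitary.conjStarAlgAut ℂ (Unitization ℂ A) w) ?_ ?_
  · exact EquivLike.injective _
  · exact Unitization.inr_injective

theorem unitizationConj_eq_inr (w : unitary (Unitization ℂ A)) (a : A) :
    unitizationConj w a = ((unitizationConj w a).snd : Unitization ℂ A) := by
  have h : (unitizationConj w a).fst = 0 := by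
    rw [unitizationConj_apply]; simp
  exact Unitization.ext (by simp [h]) (by simp)

theorem norm_unitizationConj_sub_le (w : unitary (Unitization ℂ A)) (a : A) :
    ‖unitizationConj w a - a‖ ≤ 2 * ‖(w : Unitization ℂ A) - 1‖ * ‖a‖ := by
  have hw : ‖star (w : Unitization ℂ A)‖ ≤ 1 := by
    rw [norm_star]; exact CStarRing.norm_coe_unitary w |>.le
  have e : unitizationConj w a - a = (w - 1) * (a : Unitization ℂ A) * star (w : Unitization ℂ A) +
      a * star ((w : Unitization ℂ A) - 1) := by
    rw [unitizationConj_apply, star_sub, star_one]; noncomm_ring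
  rw [e]
  have h1 : ‖((w : Unitization ℂ A) - 1) * a * star (w : Unitization ℂ A)‖ ≤
      ‖(w : Unitization ℂ A) - 1‖ * ‖a‖ * 1 := by
    refine (norm_mul_le _ _).trans (mul_le_mul ((norm_mul_le _ _).trans ?_) hw (norm_nonneg _)
      (by positivity))
    rw [Unitization.norm_inr]
  have h2 : ‖(a : Unitization ℂ A) * star ((w : Unitization ℂ A) - 1)‖ ≤
      ‖a‖ * ‖(w : Unitization ℂ A) - 1‖ := by
    refine (norm_mul_le _ _).trans ?_
    rw [Unitization.norm_inr, norm_star]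
  refine (norm_add_le _ _).trans ?_
  linarith

/-- In a locally finite-dimensional algebra the approximating subalgebra can be chosen to contain
a given finite-dimensional one. -/
theorem IsLocallyAF.exists_le (h : IsLocallyAF A) (F : NonUnitalStarSubalgebra ℂ A)
    [FiniteDimensional ℂ F] (s : Finset A) {ε : ℝ} (hε : 0 < ε) :
    ∃ G : NonUnitalStarSubalgebra ℂ A, FiniteDimensional ℂ G ∧ F ≤ G ∧
      ∀ a ∈ s, ∃ b ∈ G, ‖a - b‖ < ε := by
  classical
  have hF : IsClosed (F : Set A) := F.isClosed_of_finiteDimensional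
  have := finite_unitization F
  set M : ℝ := 1 + ∑ a ∈ s, ‖a‖ with hM
  have hs0 : 0 ≤ ∑ a ∈ s, ‖a‖ := Finset.sum_nonneg fun a _ => norm_nonneg a
  have hM0 : 0 < M := by positivity
  have hMs (a) (ha : a ∈ s) : ‖a‖ ≤ M := by
    have := Finset.single_le_sum (f := fun a : A => ‖a‖) (fun a _ => norm_nonneg a) ha
    linarith
  -- Conjugation moves an element of norm at most `M + ε` by at most `2 · ε / (8 (M + ε)) · (M + ε)
  -- = ε / 4`. As `δ` and `t` depend only on `F` and the tolerance, `B` may be chosen afterwards.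
  obtain ⟨δ, hδ, t, ht⟩ := exists_unitary_conjugation.{u} (Unitization ℂ F)
    (ε := ε / (8 * (M + ε))) (by positivity)
  obtain ⟨B, hB, hBs⟩ := h (s ∪ t.image fun x => (x.snd : A)) (min δ (ε / 4)) (by positivity)
  have hBc : IsClosed (B.adjoinUnit : Set (Unitization ℂ A)) :=
    B.isClosed_of_finiteDimensional.preimage Unitization.continuous_snd
  let ι : Unitization ℂ F →⋆ₐ[ℂ] Unitization ℂ A :=
    Unitization.starMap (NonUnitalStarSubalgebraClass.subtype F)
  have hι (x) : ι x = Unitization.inl x.fst + ((x.snd : A) : Unitization ℂ A) := by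
    induction x with | inl_add_inr r a => ?_
    rw [map_add]
    simp only [ι, Unitization.starMap_inl, Unitization.starMap_inr, Unitization.algebraMap_eq_inl]
    simp
  obtain ⟨w, hw, hw1, hwB⟩ := ht B.adjoinUnit hBc ι fun x hx => by
    obtain ⟨b, hb, hxb⟩ := hBs (x.snd : A)
      (Finset.mem_union_right _ (Finset.mem_image_of_mem (fun x => (x.snd : A)) hx))
    refine ⟨Unitization.inl x.fst + (b : Unitization ℂ A), ?_, ?_⟩
    · rw [NonUnitalStarSubalgebra.mem_adjoinUnit]; simpa using hb
    · rw [hι, add_sub_add_left_eq_sub, ← Unitization.inr_sub, Unitization.norm_inr]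
      exact hxb.le.trans (min_le_left _ _)
  let W : unitary (Unitization ℂ A) := ⟨w, hw⟩
  let B' : NonUnitalStarSubalgebra ℂ (Unitization ℂ A) :=
    B.map (Unitization.inrNonUnitalStarAlgHom ℂ A)
  have hB' (x) : x ∈ B' ↔ ∃ b ∈ B, (b : Unitization ℂ A) = x := NonUnitalStarSubalgebra.mem_map
  -- The new subalgebra is `w* B w`, which contains `F` because `w F w* ⊆ B`. It lies in `A` because
  -- `A` is an ideal of its unitization.
  refine ⟨B'.comap (unitizationConj W), ?_, fun x hx => ?_, fun a ha => ?_⟩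
  · let g : B'.comap (unitizationConj W) →ₗ[ℂ] B :=
      { toFun x := ⟨(unitizationConj W (x : A)).snd, by
          obtain ⟨b, hb, hbx⟩ := (hB' _).1 x.2
          have e : (b : Unitization ℂ A) = unitizationConj W x := hbx
          rw [← e]; simpa using hb⟩
        map_add' x y := by ext; simp
        map_smul' c x := by ext; simp }
    refine Module.Finite.of_injective g fun x y hxy => ?_
    have h1 : (unitizationConj W (x : A)).snd = (unitizationConj W (y : A)).snd :=
      congrArg Subtype.val hxy
    refine Subtype.ext (unitizationConj_injective W ?_)
    rw [unitizationConj_eq_inr, h1, ← unitizationConj_eq_inr]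
  · rw [NonUnitalStarSubalgebra.mem_comap, hB']
    refine ⟨_, ?_, (unitizationConj_eq_inr W x).symm⟩
    have := hwB ((⟨x, hx⟩ : F) : Unitization ℂ F)
    rw [NonUnitalStarSubalgebra.mem_adjoinUnit, hι] at this
    rw [unitizationConj_apply]
    simpa using this
  · obtain ⟨b, hb, hab⟩ := hBs a (Finset.mem_union_left _ ha)
    have hab4 : ‖a - b‖ < ε / 4 := hab.trans_le (min_le_right _ _)
    refine ⟨(unitizationConj (star W) b).snd, ?_, ?_⟩
    · rw [NonUnitalStarSubalgebra.mem_comap, hB']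
      refine ⟨b, hb, ?_⟩
      rw [unitizationConj_apply, ← unitizationConj_eq_inr, unitizationConj_apply]
      have hww : w * star w = 1 := Unitary.mul_star_self_of_mem hw
      have : (W : Unitization ℂ A) = w := rfl
      rw [Unitary.coe_star, this, star_star]
      calc (b : Unitization ℂ A) = w * star w * b * (w * star w) := by rw [hww, one_mul, mul_one]
        _ = _ := by simp only [mul_assoc]
    · have h1 := norm_unitizationConj_sub_le (star W) b
      rw [unitizationConj_eq_inr, ← Unitization.inr_sub, Unitization.norm_inr] at h1
      have h2 : ‖((star W : unitary (Unitization ℂ A)) : Unitization ℂ A) - 1‖ ≤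
          ε / (8 * (M + ε)) := by
        rw [Unitary.coe_star, ← norm_star, star_sub, star_star, star_one]; exact hw1
      have h3 : ‖b‖ ≤ M + ε := by
        have := norm_sub_norm_le b a
        rw [norm_sub_rev] at this
        linarith [hMs a ha]
      have h4 : 2 * ‖((star W : unitary (Unitization ℂ A)) : Unitization ℂ A) - 1‖ * ‖b‖ ≤
          2 * (ε / (8 * (M + ε))) * (M + ε) := by gcongr
      have h5 : 2 * (ε / (8 * (M + ε))) * (M + ε) = ε / 4 := by field_simp; ring
      have h6 := norm_sub_le (a - b) ((unitizationConj (star W) b).snd - b)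
      rw [sub_sub_sub_cancel_right] at h6
      linarith

/-- A separable locally finite-dimensional C*-algebra is AF. -/
theorem IsLocallyAF.isAFAlgebra [TopologicalSpace.SeparableSpace A] (h : IsLocallyAF A) :
    IsAFAlgebra A := by
  classical
  let d : ℕ → A := TopologicalSpace.denseSeq A
  have hstep (n : ℕ) (F : {F : NonUnitalStarSubalgebra ℂ A // FiniteDimensional ℂ F}) :
      ∃ G : {G : NonUnitalStarSubalgebra ℂ A // FiniteDimensional ℂ G}, F.1 ≤ G.1 ∧
        ∀ i ≤ n, ∃ b ∈ G.1, ‖d i - b‖ < 1 / ((n : ℝ) + 1) := by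
    have := F.2
    obtain ⟨G, hG, hFG, hGs⟩ := h.exists_le F.1 ((Finset.range (n + 1)).image d)
      (ε := 1 / ((n : ℝ) + 1)) (by positivity)
    exact ⟨⟨G, hG⟩, hFG, fun i hi => hGs _ (Finset.mem_image_of_mem d (by simpa using! by omega))⟩
  choose next hle happ using hstep
  have hbot : FiniteDimensional ℂ (⊥ : NonUnitalStarSubalgebra ℂ A) := by
    refine Module.Finite.of_injective (0 : _ →ₗ[ℂ] ℂ) fun x y _ => ?_
    have hx := x.2
    have hy := y.2
    rw [NonUnitalStarAlgebra.mem_bot] at hx hy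
    exact Subtype.ext (hx.trans hy.symm)
  -- `S (n + 1)` contains `S n` and approximates `d 0, …, d n` within `1 / (n + 1)`.
  let S : ℕ → {F : NonUnitalStarSubalgebra ℂ A // FiniteDimensional ℂ F} :=
    fun n => Nat.rec ⟨⊥, hbot⟩ (fun n F => next n F) n
  refine ⟨fun n => (S n).1, monotone_nat_of_le_succ fun n => hle n (S n), fun n => (S n).2, ?_⟩
  refine Metric.dense_iff.2 fun x r hr => ?_
  obtain ⟨i, hi⟩ := (TopologicalSpace.denseRange_denseSeq A).exists_dist_lt x (half_pos hr)
  obtain ⟨m, hm⟩ := exists_nat_one_div_lt (half_pos hr)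
  obtain ⟨b, hb, hdb⟩ := happ (max m i) (S (max m i)) i (le_max_right _ _)
  refine ⟨b, ?_, Set.mem_iUnion.2 ⟨max m i + 1, hb⟩⟩
  have h1 : 1 / (((max m i : ℕ) : ℝ) + 1) ≤ 1 / ((m : ℝ) + 1) := by
    gcongr
    exact le_max_left _ _
  rw [← dist_eq_norm] at hdb
  rw [Metric.mem_ball, dist_comm]
  have := dist_triangle x (d i) b
  change dist x (d i) < r / 2 at hi
  linarith

end IncreasingSequence

/-! ### Extending the trace of a finite-dimensional subalgebra. -/

section TraceExtension

/-- Compression by the negative part detects positivity. -/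
theorem IsSelfAdjoint.exists_negative_compression {A : Type*} [NonUnitalCStarAlgebra A]
    [PartialOrder A] [StarOrderedRing A] {x : A} (hx : IsSelfAdjoint x) :
    ∃ y b : A, star y = y ∧ y * x * y = -(star b * b) ∧ (b = 0 → 0 ≤ x) := by
  have hy : 0 ≤ x⁻ := CFC.negPart_nonneg x
  have hys : star x⁻ = x⁻ := (IsSelfAdjoint.of_nonneg hy).star_eq
  have h3 : 0 ≤ star x⁻ * x⁻ * x⁻ := star_left_conjugate_nonneg hy x⁻
  obtain ⟨b, hb⟩ := CStarAlgebra.exists_eq_star_mul_self h3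
  rw [hys] at hb
  -- Compressing `x` by its negative part gives `-(x⁻)³`.
  refine ⟨x⁻, b, hys, ?_, fun h0 => ?_⟩
  · rw [← hb]
    nth_rw 2 [← CFC.posPart_sub_negPart x hx]
    rw [mul_sub, CFC.negPart_mul_posPart, zero_sub, neg_mul]
  · rw [h0, mul_zero] at hb
    have h2 : x⁻ * x⁻ = 0 := by
      rw [← CStarRing.star_mul_self_eq_zero_iff, star_mul, hys, ← mul_assoc, hb, zero_mul]
    have h1 : x⁻ = 0 := by rw [← CStarRing.star_mul_self_eq_zero_iff, hys, h2]
    have := CFC.posPart_sub_negPart x hx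
    rw [h1, sub_zero] at this
    rw [← this]
    exact CFC.posPart_nonneg x

variable {F A : Type*} [NonUnitalCStarAlgebra F] [PartialOrder F] [StarOrderedRing F]
  [NonUnitalCStarAlgebra A] [PartialOrder A] [StarOrderedRing A]

/-- Compressing `ι x ≥ 0` by `ι y` shows `-(ι b)* (ι b) ≥ 0`, so `ι b = 0`, and injectivity gives `b
= 0`. -/
theorem NonUnitalStarAlgHom.nonneg_of_map_nonneg {ι : F →⋆ₙₐ[ℂ] A} (hι : Function.Injective ι)
    {x : F} (hx : IsSelfAdjoint x) (h : 0 ≤ ι x) : 0 ≤ x := by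
  obtain ⟨y, b, hy, hyb, hb⟩ := hx.exists_negative_compression
  refine hb (hι ?_)
  have h1 : 0 ≤ star (ι y) * ι x * ι y := star_left_conjugate_nonneg h _
  rw [← map_star ι, hy, ← map_mul, ← map_mul, hyb, map_neg, map_mul, map_star] at h1
  have h2 : star (ι b) * ι b = 0 := le_antisymm (neg_nonneg.1 h1) (star_mul_self_nonneg _)
  rw [map_zero]
  exact CStarRing.star_mul_self_eq_zero_iff _ |>.1 h2

variable [FiniteDimensional ℂ F]

theorem re_regularTrace_nonneg {x : F} (hx : 0 ≤ x + star x) : 0 ≤ (regularTrace F x).re := by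
  obtain ⟨b, hb⟩ := CStarAlgebra.exists_eq_star_mul_self hx
  obtain ⟨r, hr, hr0, -⟩ := regularTrace_star_mul_self b
  rw [← hb, map_add, regularTrace_star] at hr
  have := congrArg Complex.re hr
  simp at this
  linarith

/-- The elements whose compression by `p` has nonnegative real part. -/
def compressionCone (p : A) : PointedCone ℝ A where
  carrier := {a | 0 ≤ p * (a + star a) * p}
  add_mem' {a b} ha hb := by
    have e : p * (a + b + star (a + b)) * p = p * (a + star a) * p + p * (b + star b) * p := by
      rw [star_add]; noncomm_ring
    change 0 ≤ p * (a + b + star (a + b)) * p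
    rw [e]
    exact add_nonneg ha hb
  zero_mem' := by simp
  smul_mem' c a ha := by
    have e : p * ((c : ℝ) • a + star ((c : ℝ) • a)) * p = (c : ℝ) • (p * (a + star a) * p) := by
      rw [star_smul, star_trivial, ← smul_add, mul_smul_comm, smul_mul_assoc]
    change 0 ≤ p * ((c : ℝ) • a + star ((c : ℝ) • a)) * p
    rw [e]
    exact smul_nonneg c.2 ha

/-- The trace of a finite-dimensional subalgebra extends to a positive functional. -/
theorem exists_positive_extension_regularTrace {ι : F →⋆ₙₐ[ℂ] A} (hι : Function.Injective ι) :
    ∃ ω : A →ₗ[ℂ] ℂ, (∀ x, ω (ι x) = regularTrace F x) ∧ (∀ a, ω (star a) = star (ω a)) ∧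
      ∀ a, 0 ≤ (ω (star a * a)).re := by
  obtain ⟨u, hu, hux⟩ := exists_unit_of_finiteDimensional F
  have hp : star (ι u) = ι u := by rw [← map_star, hu.isSelfAdjoint.star_eq]
  have hpp : ι u * ι u = ι u := by rw [← map_mul, hu.isIdempotentElem.eq]
  let ιR : F →ₗ[ℝ] A := ((ι : F →ₗ[ℂ] A).restrictScalars ℝ)
  have hιR : Function.Injective ιR := hι
  let τR : F →ₗ[ℝ] ℝ := Complex.reLm.comp ((regularTrace F).restrictScalars ℝ)
  let f : A →ₗ.[ℝ] ℝ :=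
    ⟨LinearMap.range ιR, τR.comp (LinearEquiv.ofInjective ιR hιR).symm.toLinearMap⟩
  have hf (x : F) : f ⟨ιR x, x, rfl⟩ = (regularTrace F x).re := by
    have : (LinearEquiv.ofInjective ιR hιR).symm ⟨ιR x, x, rfl⟩ = x :=
      (LinearEquiv.symm_apply_eq _).2 rfl
    change (regularTrace F ((LinearEquiv.ofInjective ιR hιR).symm ⟨ιR x, x, rfl⟩)).re = _
    rw [this]
  obtain ⟨g, hgf, hg⟩ := riesz_extension (compressionCone (ι u)) f (by
    rintro ⟨_, x, rfl⟩ hx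
    rw [hf]
    refine re_regularTrace_nonneg (NonUnitalStarAlgHom.nonneg_of_map_nonneg hι ?_ ?_)
    · exact IsSelfAdjoint.add_star_self x
    · have h1 : 0 ≤ ι u * (ι x + star (ι x)) * ι u := hx
      rwa [← map_star, ← map_add, ← map_mul, ← map_mul, (hux _).1, (hux _).2] at h1) (by
    intro y
    -- Riesz extension needs the domain to dominate every element modulo the cone: with `p = ι u`
    -- one has `p (y + y*) p ≥ -2 ‖y‖ p`.
    refine ⟨⟨ιR ((‖y‖ : ℝ) • u), _, rfl⟩, ?_⟩
    have hz : IsSelfAdjoint (-(y + star y)) := (IsSelfAdjoint.add_star_self y).neg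
    have h1 := CStarAlgebra.star_left_conjugate_le_norm_smul (a := ι u) (b := -(y + star y)) hz
    rw [hp, hpp, norm_neg] at h1
    have h2 : ‖y + star y‖ ≤ 2 * ‖y‖ := by
      have := norm_add_le y (star y)
      rw [norm_star] at this
      linarith
    have h3 : ‖y + star y‖ • ι u ≤ (2 * ‖y‖) • ι u := by
      have : 0 ≤ ι u := by
        rw [← hpp]; nth_rw 1 [← hp]; exact star_mul_self_nonneg _
      exact smul_le_smul_of_nonneg_right h2 this
    have h4 := h1.trans h3
    rw [mul_neg, neg_mul, neg_le_iff_add_nonneg] at h4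
    have e : ι u * ((ιR ((‖y‖ : ℝ) • u) + y) + star (ιR ((‖y‖ : ℝ) • u) + y)) * ι u =
        (2 * ‖y‖) • ι u + ι u * (y + star y) * ι u := by
      have e1 : ιR ((‖y‖ : ℝ) • u) = ‖y‖ • ι u := map_smul ιR _ _
      rw [e1, star_add, star_smul, star_trivial, hp, two_mul, add_smul]
      have e2 : ι u * (‖y‖ • ι u) * ι u = ‖y‖ • ι u := by
        rw [mul_smul_comm, smul_mul_assoc, hpp, hpp]
      rw [show ‖y‖ • ι u + y + (‖y‖ • ι u + star y) = ‖y‖ • ι u + ‖y‖ • ι u + (y + star y) by abel,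
        mul_add, mul_add, add_mul, add_mul, e2]
    change 0 ≤ ι u * ((ιR ((‖y‖ : ℝ) • u) + y) + star (ιR ((‖y‖ : ℝ) • u) + y)) * ι u
    rw [e]
    exact h4)
  -- Skew elements lie in the cone together with their negatives, so the real functional `g` is
  -- *-invariant and its complexification is hermitian.
  have hskew (a : A) (ha : star a = -a) : g a = 0 := by
    have h1 : 0 ≤ g a := hg a (by
      change 0 ≤ ι u * (a + star a) * ι u
      rw [ha, add_neg_cancel, mul_zero, zero_mul])
    have h2 : 0 ≤ g (-a) := hg (-a) (by
      change 0 ≤ ι u * (-a + star (-a)) * ι u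
      rw [star_neg, ha, add_neg_cancel, mul_zero, zero_mul])
    rw [map_neg] at h2
    linarith
  have hgstar (a : A) : g (star a) = g a := by
    have := hskew (star a - a) (by rw [star_sub, star_star, neg_sub])
    rw [map_sub] at this
    linarith
  have hgι (x : F) : g (ι x) = (regularTrace F x).re := by
    rw [← hf x, ← hgf]; rfl
  have hre (a : A) : (Module.Dual.extendRCLike (𝕜 := ℂ) g a).re = g a :=
    Module.Dual.re_extendRCLike_apply (𝕜 := ℂ) g a
  have him (a : A) : (Module.Dual.extendRCLike (𝕜 := ℂ) g a).im = -g (Complex.I • a) :=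
    Module.Dual.im_extendRCLike_apply (𝕜 := ℂ) g a
  refine ⟨Module.Dual.extendRCLike (𝕜 := ℂ) g, fun x => ?_, fun a => ?_, fun a => ?_⟩
  · apply Complex.ext
    · rw [hre, hgι]
    · rw [him, ← map_smul, hgι, map_smul]; simp
  · apply Complex.ext
    · simp [hre, hgstar]
    · have e : Complex.I • star a = -star (Complex.I • a) := by simp
      have : g (Complex.I • star a) = -g (Complex.I • a) := by rw [e, map_neg, hgstar]
      simp [him, this]
  · rw [hre]
    refine hg _ ?_
    have h0 : 0 ≤ star a * a := star_mul_self_nonneg a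
    change 0 ≤ ι u * (star a * a + star (star a * a)) * ι u
    nth_rw 1 [← hp]
    refine star_left_conjugate_nonneg (add_nonneg h0 ?_) _
    rw [star_mul, star_star]
    exact h0

/-- The extension of the trace can be chosen to be invariant under the subalgebra. -/
theorem exists_invariant_extension_regularTrace {ι : F →⋆ₙₐ[ℂ] A} (hι : Function.Injective ι) :
    ∃ ω : A →ₗ[ℂ] ℂ, (∀ x, ω (ι x) = regularTrace F x) ∧ (∀ a, ω (star a) = star (ω a)) ∧
      (∀ a, 0 ≤ (ω (star a * a)).re) ∧ ∀ x a, ω (ι x * a) = ω (a * ι x) := by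
  obtain ⟨ω, hω, hωs, hωp⟩ := exists_positive_extension_regularTrace hι
  obtain ⟨u, hu, hux⟩ := exists_unit_of_finiteDimensional F
  obtain ⟨n, f, hf⟩ := exists_isTraceFrame F
  -- Averaging against the Casimir element replaces averaging over the unitary group: the Casimir
  -- property gives invariance, and `∑ f i (f i)* = 1` leaves the values on `F` unchanged.
  let ω' : A →ₗ[ℂ] ℂ := ∑ i, ω ∘ₗ (LinearMap.mulLeft ℂ (ι (star (f i)))) ∘ₗ
    (LinearMap.mulRight ℂ (ι (f i)))
  have hω' (a : A) : ω' a = ∑ i, ω (ι (star (f i)) * (a * ι (f i))) := by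
    simp [ω', LinearMap.sum_apply]
  refine ⟨ω', fun x => ?_, fun a => ?_, fun a => ?_, fun x a => ?_⟩
  · have h (i) : ω (ι (star (f i)) * (ι x * ι (f i))) = regularTrace F (x * (f i * star (f i))) := by
      rw [← map_mul, ← map_mul, hω, regularTrace_mul_comm, mul_assoc]
    rw [hω', Finset.sum_congr rfl fun i _ => h i, ← map_sum, ← Finset.mul_sum,
      hf.sum_mul_star fun x => (hux x).2, (hux x).2]
  · rw [hω', hω', star_sum]
    refine Finset.sum_congr rfl fun i _ => ?_
    rw [← hωs]
    simp only [star_mul, ← map_star, star_star, mul_assoc]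
  · rw [hω', Complex.re_sum]
    refine Finset.sum_nonneg fun i _ => ?_
    have := hωp (a * ι (f i))
    rwa [star_mul, ← map_star, mul_assoc, ← mul_assoc (star a)] at this
  · let β : F →ₗ[ℂ] F →ₗ[ℂ] ℂ := LinearMap.mk₂ ℂ (fun y z => ω (ι z * (a * ι y)))
      (fun y y' z => by simp [mul_add])
      (fun c y z => by rw [map_smul, mul_smul_comm, mul_smul_comm, map_smul])
      (fun y z z' => by simp [add_mul]) (fun c y z => by rw [map_smul, smul_mul_assoc, map_smul])
    have := hf.casimir β x
    simp only [β, LinearMap.mk₂_apply, map_mul] at this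
    rw [hω', hω']
    simp only [mul_assoc] at this ⊢
    exact this.symm

end TraceExtension

/-! ### Conditional expectations onto finite-dimensional subalgebras. -/

section ConditionalExpectation

/-- A matrix over a C*-algebra is positive if all its quadratic forms are. -/
theorem CStarMatrix.nonneg_of_forall_sum_nonneg {A : Type*} [NonUnitalCStarAlgebra A]
    [PartialOrder A] [StarOrderedRing A] {n : Type*} [Fintype n] {M : CStarMatrix n n A}
    (hM : IsSelfAdjoint M) (h : ∀ v : n → A, 0 ≤ ∑ i, ∑ j, star (v i) * M i j * v j) : 0 ≤ M := by
  -- The diagonal entries of `Y M Y = -B* B` are quadratic forms of `M` at the columns of `Y`, hence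
  -- positive; this forces the columns of `B` to vanish.
  obtain ⟨Y, B, hY, hYB, hB⟩ := hM.exists_negative_compression
  refine hB (CStarMatrix.ext fun l k => ?_)
  have h1 : (Y * M * Y) k k = ∑ i, ∑ j, star (Y i k) * M i j * Y j k := by
    rw [CStarMatrix.mul_apply, Finset.sum_comm]
    refine Finset.sum_congr rfl fun j _ => ?_
    rw [CStarMatrix.mul_apply, Finset.sum_mul]
    refine Finset.sum_congr rfl fun i _ => ?_
    nth_rw 1 [← hY]
    rfl
  have h2 : (star B * B) k k = ∑ i, star (B i k) * B i k := by
    rw [CStarMatrix.mul_apply]; rfl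
  have h3 : ∑ i, star (B i k) * B i k ≤ 0 := by
    rw [← h2, ← neg_nonneg]
    have h4 := h fun i => Y i k
    rw [← h1, hYB] at h4
    exact h4
  have h5 : star (B l k) * B l k = 0 := by
    refine le_antisymm (le_trans ?_ h3) (star_mul_self_nonneg _)
    exact Finset.single_le_sum (f := fun i => star (B i k) * B i k)
      (fun i _ => star_mul_self_nonneg _) (Finset.mem_univ l)
  exact CStarRing.star_mul_self_eq_zero_iff _ |>.1 h5

variable {F A : Type*} [NonUnitalCStarAlgebra F] [PartialOrder F] [StarOrderedRing F]
  [NonUnitalCStarAlgebra A] [PartialOrder A] [StarOrderedRing A] [FiniteDimensional ℂ F]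

theorem nonneg_of_forall_regularTrace_nonneg {x : F} (hx : IsSelfAdjoint x)
    (h : ∀ z, 0 ≤ (regularTrace F (star z * x * z)).re) : 0 ≤ x := by
  obtain ⟨y, b, hy, hyb, hb⟩ := hx.exists_negative_compression
  obtain ⟨r, hr, hr0, hrb⟩ := regularTrace_star_mul_self b
  have h1 := h y
  rw [hy, hyb, map_neg, hr, Complex.neg_re, Complex.ofReal_re] at h1
  exact hb (hrb (le_antisymm (by linarith) hr0))

/-- A conditional expectation onto a finite-dimensional subalgebra. -/
structure IsConditionalExpectation (ι : F →⋆ₙₐ[ℂ] A) (E : A →ₗ[ℂ] F) : Prop where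
  map_incl : ∀ x, E (ι x) = x
  map_star : ∀ a, E (star a) = star (E a)
  incl_mul : ∀ x a, E (ι x * a) = x * E a
  mul_incl : ∀ x a, E (a * ι x) = E a * x
  map_nonneg : ∀ a, 0 ≤ a → 0 ≤ E a

theorem exists_isConditionalExpectation {ι : F →⋆ₙₐ[ℂ] A} (hι : Function.Injective ι) :
    ∃ E : A →ₗ[ℂ] F, IsConditionalExpectation ι E := by
  obtain ⟨ω, hω, hωs, hωp, hωc⟩ := exists_invariant_extension_regularTrace hι
  obtain ⟨n, f, hf⟩ := exists_isTraceFrame F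
  let E : A →ₗ[ℂ] F := ∑ i, (ω ∘ₗ LinearMap.mulRight ℂ (ι (f i))).smulRight (star (f i))
  have hE (a : A) : E a = ∑ i, ω (a * ι (f i)) • star (f i) := by
    simp [E, LinearMap.sum_apply]
  -- This duality determines `E`. The properties of `E` are read off from those of `ω` because `τ`
  -- is faithful.
  have hτ (a : A) (x : F) : regularTrace F (E a * x) = ω (a * ι x) := by
    conv_rhs => rw [hf.expand x]
    rw [hE, Finset.sum_mul, map_sum, map_sum, Finset.mul_sum, map_sum]
    refine Finset.sum_congr rfl fun i _ => ?_
    rw [smul_mul_assoc, map_smul, map_smul, mul_smul_comm, map_smul, smul_eq_mul, smul_eq_mul,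
      mul_comm]
  have hτ' (a : A) (x : F) : regularTrace F (x * E a) = ω (a * ι x) := by
    rw [regularTrace_mul_comm, hτ]
  have hstar (a : A) : E (star a) = star (E a) := eq_of_forall_regularTrace_mul_eq fun z => by
    rw [hτ', ← star_star z, ← star_mul, regularTrace_star, hτ, ← hωs, star_mul, ← map_star,
      hωc]
  have hmul (x : F) (a : A) : E (a * ι x) = E a * x := eq_of_forall_regularTrace_mul_eq fun z => by
    rw [hτ', ← mul_assoc, regularTrace_mul_comm, ← mul_assoc, hτ', mul_assoc, ← map_mul]
  have hmul' (x : F) (a : A) : E (ι x * a) = x * E a :=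
    eq_of_forall_regularTrace_mul_eq fun z => by
      rw [hτ', ← mul_assoc, hτ', mul_assoc, hωc, mul_assoc, ← map_mul]
  refine ⟨E, fun x => eq_of_forall_regularTrace_mul_eq fun z => ?_, hstar, hmul', hmul,
    fun a ha => nonneg_of_forall_regularTrace_nonneg ?_ fun z => ?_⟩
  · rw [hτ', ← map_mul, hω, regularTrace_mul_comm]
  · rw [IsSelfAdjoint, ← hstar, (IsSelfAdjoint.of_nonneg ha).star_eq]
  · obtain ⟨b, rfl⟩ := CStarAlgebra.exists_eq_star_mul_self ha
    have := hωp (b * ι z)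
    rw [mul_assoc, regularTrace_mul_comm, mul_assoc, hτ, map_mul ι, ← mul_assoc, ← hωc]
    rwa [star_mul, ← map_star, mul_assoc, ← mul_assoc (star b)] at this

namespace IsConditionalExpectation

variable {ι : F →⋆ₙₐ[ℂ] A} {E : A →ₗ[ℂ] F}

omit [FiniteDimensional ℂ F] in
-- Schwarz inequality: apply `E` to the square of `a - ι (E a)` and expand by the bimodule property.
theorem star_mul_self_le (h : IsConditionalExpectation ι E) (a : A) :
    star (E a) * E a ≤ E (star a * a) := by
  have h0 := h.map_nonneg _ (star_mul_self_nonneg (a - ι (E a)))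
  have e : star (a - ι (E a)) * (a - ι (E a)) = star a * a - star a * ι (E a) -
      ι (star (E a)) * a + ι (star (E a) * E a) := by
    rw [star_sub, map_mul, StarHomClass.map_star]; noncomm_ring
  rw [e, map_add, map_sub, map_sub, h.mul_incl, h.incl_mul, h.map_incl, h.map_star] at h0
  rw [← sub_nonneg]
  convert h0 using 1
  abel

/-- `E` sees only the corner at the unit `u` of `F`, where `a* a` is at most `‖a‖² u`; combine this
with the Schwarz inequality. -/
theorem norm_le (h : IsConditionalExpectation ι E) (a : A) : ‖E a‖ ≤ ‖a‖ := by
  obtain ⟨u, hu, hux⟩ := exists_unit_of_finiteDimensional F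
  have hup : star u = u := hu.isSelfAdjoint.star_eq
  have hu1 : ‖u‖ ≤ 1 := by
    have h1 : ‖u‖ * ‖u‖ = ‖u‖ := by
      rw [← CStarRing.norm_star_mul_self, hup, hu.isIdempotentElem.eq]
    nlinarith [norm_nonneg u]
  have h2 : E (star a * a) ≤ (‖a‖ * ‖a‖) • u := by
    have h3 := CStarAlgebra.star_left_conjugate_le_norm_smul (a := ι u)
      (b := star a * a) (IsSelfAdjoint.star_mul_self a)
    rw [CStarRing.norm_star_mul_self, ← StarHomClass.map_star, hup, ← map_mul,
      hu.isIdempotentElem.eq, ← sub_nonneg] at h3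
    have h4 := h.map_nonneg _ h3
    have h5 : E ((‖a‖ * ‖a‖) • ι u) = (‖a‖ * ‖a‖) • u := by
      rw [← Complex.coe_smul, map_smul, h.map_incl, Complex.coe_smul]
    rwa [map_sub, h5, h.mul_incl, h.incl_mul, (hux _).1, (hux _).2, sub_nonneg] at h4
  have h6 := CStarAlgebra.norm_le_norm_of_nonneg_of_le (star_mul_self_nonneg (E a))
    ((h.star_mul_self_le a).trans h2)
  rw [CStarRing.norm_star_mul_self, norm_smul, Real.norm_of_nonneg (by positivity)] at h6
  have h7 : ‖a‖ * ‖a‖ * ‖u‖ ≤ ‖a‖ * ‖a‖ * 1 := by gcongr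
  nlinarith [norm_nonneg a, norm_nonneg (E a)]

/-- Conditional expectations are completely positive. -/
def toCompletelyPositiveMap (h : IsConditionalExpectation ι E) : A →CP F where
  toLinearMap := E
  map_cstarMatrix_nonneg' k M hM := by
    refine CStarMatrix.nonneg_of_forall_sum_nonneg ?_ fun v => ?_
    · have hMs : star M = M := (IsSelfAdjoint.of_nonneg hM).star_eq
      refine CStarMatrix.ext fun i j => ?_
      change star (E (M j i)) = E (M i j)
      rw [← h.map_star]
      nth_rw 2 [← hMs]
      rfl
    -- By the bimodule property the quadratic form of `E M` at `v` is `E` of the quadratic form of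
    -- `M` at `ι v`.
    · have h1 := h.map_nonneg _ (CStarMatrix.sum_star_mul_mul_nonneg hM fun i => ι (v i))
      simp only [map_sum] at h1
      convert h1 using 4 with i _ j _
      rw [← StarHomClass.map_star, h.mul_incl, h.incl_mul]
      rfl

end IsConditionalExpectation

end ConditionalExpectation

/-! ### The two implications. -/

section Main

variable {A : Type u} [NonUnitalCStarAlgebra A] [PartialOrder A] [StarOrderedRing A]

/-- An AF algebra has completely positive rank at most zero. -/
theorem IsAFAlgebra.cprankLE (h : IsAFAlgebra A) : CPRankLE A 0 := by
  obtain ⟨S, hS, hfin, hd⟩ := h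
  intro k a ε hε
  have hn (i) : ∃ n, ∃ b ∈ S n, ‖a i - b‖ < ε / 2 := by
    obtain ⟨b, hab, hb⟩ := Metric.dense_iff.1 hd (a i) (ε / 2) (half_pos hε)
    obtain ⟨n, hn⟩ := Set.mem_iUnion.1 hb
    refine ⟨n, b, hn, ?_⟩
    rwa [Metric.mem_ball, dist_comm, dist_eq_norm] at hab
  choose n b hb hab using hn
  have := hfin (Finset.univ.sup n)
  set B := S (Finset.univ.sup n) with hB
  have hbB (i) : b i ∈ B := hS (Finset.le_sup (Finset.mem_univ i)) (hb i)
  have hBc : IsClosed (B : Set A) := B.isClosed_of_finiteDimensional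
  let _ : PartialOrder B := CStarAlgebra.spectralOrder B
  have : StarOrderedRing B := CStarAlgebra.spectralOrderedRing B
  let ι : B →⋆ₙₐ[ℂ] A := NonUnitalStarSubalgebraClass.subtype B
  obtain ⟨E, hE⟩ := exists_isConditionalExpectation (ι := ι) Subtype.val_injective
  refine ⟨⟨B, hE.toCompletelyPositiveMap,
    CompletelyPositiveMapClass.toCompletelyPositiveLinearMap ι, hE.norm_le, fun x => le_rfl⟩,
    fun i => ?_, fun m hm e he => ?_⟩
  -- `E` fixes `b i`, so the error comes only from `a i - b i` and is at most twice its norm.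
  · have e1 : ι (E (a i)) - a i = ι (E (a i - b i)) - (a i - b i) := by
      have : E (b i) = ⟨b i, hbB i⟩ := hE.map_incl ⟨b i, hbB i⟩
      rw [map_sub, map_sub, this]
      change _ = ι (E (a i)) - b i - (a i - b i)
      abel
    change ‖ι (E (a i)) - a i‖ < ε
    rw [e1]
    refine (norm_sub_le _ _).trans_lt ?_
    have h1 : ‖ι (E (a i - b i))‖ ≤ ‖a i - b i‖ := hE.norm_le _
    linarith [hab i]
  · obtain rfl : m = 2 := by omega
    refine ⟨0, 1, ?_⟩
    have h01 := he.2 0 1 (by decide)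
    change ι (e 0) * ι (e 1) = 0
    rw [← map_mul, h01, map_zero]

/-- For `n = -1` elementary sets are single minimal projections, so `φ` vanishes on all of them and
hence on their span `F`. Then `φ ψ` cannot approximate `a ≠ 0` with tolerance `‖a‖`. -/
theorem not_cprankLE_neg_one [Nontrivial A] : ¬ CPRankLE A (-1) := by
  intro h
  obtain ⟨a, ha⟩ := exists_ne (0 : A)
  obtain ⟨T, hT, hT1⟩ := h 1 (fun _ => a) ‖a‖ (norm_pos_iff.2 ha)
  have hzero : ((T.φ : T.F →CP A).toLinearMap : T.F →ₗ[ℂ] A) = 0 := by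
    refine LinearMap.ext_on (span_isMinimalProjection_eq_top (F := T.F)) fun e he => ?_
    obtain ⟨-, -, hij⟩ := hT1 1 (by norm_num) (fun _ => e) ⟨fun _ => he, fun i j hij =>
      absurd (Subsingleton.elim i j) hij⟩
    have hpos : 0 ≤ e := by
      rw [← he.1.isIdempotentElem.eq]
      nth_rw 1 [← he.1.isSelfAdjoint.star_eq]
      exact star_mul_self_nonneg e
    have hs : IsSelfAdjoint (T.φ e) := IsSelfAdjoint.of_nonneg (map_nonneg T.φ hpos)
    refine CStarRing.star_mul_self_eq_zero_iff _ |>.1 ?_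
    change star (T.φ e) * T.φ e = 0
    rw [hs.star_eq, hij]
  have h0 : T.φ (T.ψ a) = 0 := congrArg (fun L : T.F →ₗ[ℂ] A => L (T.ψ a)) hzero
  have := hT 0
  rw [h0, zero_sub, norm_neg] at this
  exact lt_irrefl _ this

end Main

theorem mainTheorem1 (A : Type u) [NonUnitalCStarAlgebra A] [PartialOrder A] [StarOrderedRing A]
    [TopologicalSpace.SeparableSpace A] [Nontrivial A] :
    IsAFAlgebra A ↔ HasCPRank A 0 := by
  refine ⟨fun h => ⟨⟨by norm_num, h.cprankLE⟩, fun m hm => ?_⟩, fun h => ?_⟩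
  · by_contra hlt
    obtain rfl : m = -1 := le_antisymm (by omega) hm.1
    exact not_cprankLE_neg_one hm.2
  · exact (CPRankLE.isLocallyAF h.1.2).isAFAlgebra
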